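/- Fix $\alpha>0$, $B>0$ and constants $C_1,C_2,C_3,C_4>0$, $c_0\in\mathbb{R}$, $c_1>0$. For $\theta=(\theta_j)_{j\ge1}\in\mathbb{R}^{\infty}$ and $n\ge 1$ let $P_\theta^{(n)}=\bigotimes_{j\ge1}N(\theta_j,n^{-1})$ be the law of the observation $Y=(Y_j)_{j\ge 1}$ in the Gaussian sequence model, and let $$\Theta_\alpha(B)=\Big\{\theta:\ \sum_{j\ge1}j^{2\alpha}\theta_j^2\le B^2\Big\}.$$ For $n\ge2$ put $k_0=\big\lceil (n/\log n)^{1/(2\alpha+1)}\big\rceil$. Let $\pi$ be a probability distribution on $\{1,2,\dots\}$, let $f_1,f_2,\dots$ be probability densities on $\mathbb{R}$, and let $\Pi$ be the sieve prior $$d\Pi(\theta)=\sum_{k\ge1}\pi(k)\prod_{j\le k}f_j(\theta_j)\,d\theta_j\prod_{j>k}\delta_0(d\theta_j)$$ (both $\pi$ and the $f_j$ may depend on $n$). Assume that 1. $\sum_{j\ge k}\pi(j)\le C_1\exp(-C_2k)$ for all $k\ge1$; 2. $\pi(k_0)\ge C_3\exp(-C_4k_0\log k_0)$; 3. $-\log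 f_j(x)\le c_0+c_1j^{2\alpha+1}x^2$ for all $j\le k_0$ and $x\in\mathbb{R}$ (in particular $f_j(x)>0$). Let $\Pi(\cdot\mid Y)$ be the posterior distribution of $\theta$ given $Y$, let $\mathcal{S}_{\rm MF}$ be the class of all product probability measures $\bigotimes_{j\ge1}Q_j$ on $\mathbb{R}^\infty$, and let $\widehat Q=\widehat Q_Y$ be a mean-field variational posterior, that is, a (measurably) data-dependent measure which for almost every $Y$ minimizes the Kullback--Leibler divergence $D(Q\,\|\,\Pi(\cdot\mid Y))$ over $Q\in\mathcal{S}_{\rm MF}$ ("almost every" refers to the marginal law $\int P_\theta^{(n)}\,d\Pi(\theta)$ of the data). Then there is a constant $M>0$ depending only on $\alpha,B,C_1,C_2,C_3,C_4,c_0,c_1$ such that for every $n\ge2$, every such $\Pi$ and $\widehat Q$, and every $\theta^*\in\Theta_\alpha(B)$, $$P_{\theta^*}^{(n)}\widehat Q\|\theta-\theta^*\|^2=\int\!\int\sum_{j\ge1}(\theta_j-\theta_j^*)^2\,d\widehat Q_Y(\theta)\,dP_{\theta^*}^{(n)}(Y)\ \le\ M\,n^{-\frac{2\alpha}{2\alpha+1}}(\log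 n)^{\frac{2\alpha}{2\alpha+1}}.$$ -/

import Mathlib

open MeasureTheory ProbabilityTheory InformationTheory
open scoped ENNReal NNReal

noncomputable section

namespace GaussianSequence

/- Sequences `(θ_1, θ_2, …)` are functions `ℕ → ℝ`; the entry at index `j` is the paper's
coordinate number `j + 1`. -/

/-- The law `P_θ^{(n)} = ⊗_j N(θ_j, 1/n)` of the Gaussian sequence model. -/
def seqLaw (n : ℕ) (θ : ℕ → ℝ) : Measure (ℕ → ℝ) :=
  Measure.infinitePi fun j => gaussianReal (θ j) (n : ℝ≥0)⁻¹

instance (n : ℕ) (θ : ℕ → ℝ) : IsProbabilityMeasure (seqLaw n θ) := by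
  unfold seqLaw; infer_instance

theorem measurable_seqLaw (n : ℕ) : Measurable (seqLaw n) := by
  refine Measurable.measure_of_isPiSystem_of_isProbabilityMeasure
    (generateFrom_squareCylinders (α := fun _ : ℕ => ℝ)).symm
    (isPiSystem_squareCylinders (fun _ => MeasurableSpace.isPiSystem_measurableSet) (by simp)) ?_
  rintro _ ⟨s, t, ht, rfl⟩
  simp only [Set.mem_univ_pi, Set.mem_ofPred_eq] at ht
  simp only [seqLaw]
  simp_rw [Measure.infinitePi_pi _ (fun i _ => ht i)]
  refine Finset.measurable_prod _ fun i _ => ?_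
  have h : Measurable fun x : ℝ => gaussianReal x (n : ℝ≥0)⁻¹ :=
    measurable_gaussianReal.comp (measurable_id.prodMk measurable_const)
  exact (Measure.measurable_coe (ht i)).comp (h.comp (measurable_pi_apply i))

/-- The Gaussian sequence model `θ ↦ P_θ^{(n)}`, as a Markov kernel. -/
def model (n : ℕ) : Kernel (ℕ → ℝ) (ℕ → ℝ) where
  toFun := seqLaw n
  measurable' := measurable_seqLaw n

instance (n : ℕ) : IsMarkovKernel (model n) :=
  ⟨fun θ => inferInstanceAs (IsProbabilityMeasure (seqLaw n θ))⟩

/-- The data of a sieve prior: a probability distribution `π` on `{1, 2, …}` and, for each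
coordinate, a probability density on `ℝ`. -/
structure SievePrior where
  /-- `weight k` is `π(k)`. -/
  weight : ℕ → ℝ
  /-- `density j` is the density of coordinate number `j + 1`. -/
  density : ℕ → ℝ → ℝ
  weight_nonneg : ∀ k, 0 ≤ weight k
  weight_zero : weight 0 = 0
  weight_hasSum : HasSum weight 1
  density_measurable : ∀ j, Measurable (density j)
  density_nonneg : ∀ j x, 0 ≤ density j x
  density_lintegral : ∀ j, ∫⁻ x, ENNReal.ofReal (density j x) = 1

namespace SievePrior

variable (p : SievePrior)

/-- The law of the coordinate of index `j` given that the model dimension is `k`. -/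
def coordLaw (k j : ℕ) : Measure ℝ :=
  if j < k then volume.withDensity (fun x => ENNReal.ofReal (p.density j x)) else Measure.dirac 0

instance (k j : ℕ) : IsProbabilityMeasure (p.coordLaw k j) := by
  unfold coordLaw
  split_ifs
  · exact ⟨by simp [withDensity_apply _ MeasurableSet.univ, p.density_lintegral j]⟩
  · infer_instance

/-- The prior `Π = ∑_k π(k) ∏_{j ≤ k} f_j(θ_j) dθ_j ∏_{j > k} δ_0(dθ_j)`. -/
def toMeasure : Measure (ℕ → ℝ) :=
  Measure.sum fun k => ENNReal.ofReal (p.weight k) • Measure.infinitePi (p.coordLaw k)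

instance : IsProbabilityMeasure p.toMeasure := by
  refine ⟨?_⟩
  simp only [toMeasure, Measure.sum_apply _ MeasurableSet.univ, Measure.smul_apply, measure_univ,
    smul_eq_mul, mul_one]
  rw [← ENNReal.ofReal_tsum_of_nonneg p.weight_nonneg p.weight_hasSum.summable,
    p.weight_hasSum.tsum_eq, ENNReal.ofReal_one]

end SievePrior

/-- The mean-field class: all products of probability measures on `ℝ`. -/
def meanField : Set (Measure (ℕ → ℝ)) :=
  {Q | ∃ q : ℕ → ProbabilityMeasure ℝ, Q = Measure.infinitePi fun j => (q j : Measure ℝ)}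

/-- `Qhat` is a mean-field variational posterior: for almost every observation `Y`, `Qhat Y`
minimizes `Q ↦ D(Q ‖ Π(· | Y))` over the mean-field class. The posterior, and hence `Qhat`, is only
determined up to null sets of the marginal law of the data, `∫ P_θ^{(n)} dΠ(θ)`. -/
def IsVariationalPosterior (n : ℕ) (p : SievePrior) (Qhat : Kernel (ℕ → ℝ) (ℕ → ℝ)) : Prop :=
  ∀ᵐ Y ∂((model n) ∘ₘ p.toMeasure), Qhat Y ∈ meanField ∧
    ∀ Q ∈ meanField, klDiv (Qhat Y) (posterior (model n) p.toMeasure Y) ≤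
      klDiv Q (posterior (model n) p.toMeasure Y)

/-- The Sobolev ball `{θ : ∑_j j^{2α} θ_j² ≤ B²}`. -/
def sobolevBall (α B : ℝ) : Set (ℕ → ℝ) :=
  {θ | Summable (fun j : ℕ => ((j : ℝ) + 1) ^ (2 * α) * θ j ^ 2) ∧
    ∑' j : ℕ, ((j : ℝ) + 1) ^ (2 * α) * θ j ^ 2 ≤ B ^ 2}

/-- The squared distance `‖θ - θ'‖²`, with value `∞` if `θ - θ'` is not square summable. -/
def sqDist (θ θ' : ℕ → ℝ) : ℝ≥0∞ := ∑' j, ENNReal.ofReal ((θ j - θ' j) ^ 2)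

/-- The dimension `k_0 = ⌈(n / log n)^{1/(2α+1)}⌉`. -/
def effDim (α : ℝ) (n : ℕ) : ℕ := ⌈((n : ℝ) / Real.log n) ^ (1 / (2 * α + 1))⌉₊

/-- The prior conditions at sample size `n`. In the last one, `-log f_j(x)` is read as `+∞` where
`f_j(x) = 0`, so that the bound forces `f_j(x) > 0`. -/
structure PriorCondition (α C₁ C₂ C₃ C₄ c₀ c₁ : ℝ) (n : ℕ) (p : SievePrior) : Prop where
  tail : ∀ k : ℕ, 1 ≤ k → ∑' i : ℕ, p.weight (k + i) ≤ C₁ * Real.exp (-C₂ * k)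
  mass : C₃ * Real.exp (-C₄ * effDim α n * Real.log (effDim α n)) ≤ p.weight (effDim α n)
  density : ∀ j : ℕ, j + 1 ≤ effDim α n → ∀ x : ℝ, 0 < p.density j x ∧
    -Real.log (p.density j x) ≤ c₀ + c₁ * ((j : ℝ) + 1) ^ (2 * α + 1) * x ^ 2

end GaussianSequence

end

/-! The proof compares entropies at a fixed observation and averages over `Y` only at the end. For
small `a`, the Donsker–Varadhan inequality (`lintegral_le_klDiv_add_log`) bounds the `Qhat Y`-mean
of `a n ∑_{j<N} (θ_j - θ*_j)²` by `D(Qhat Y ‖ posterior)` plus the log of the posterior exponential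
moment. By minimality the divergence may be replaced by that of any product measure. The one used
has coordinates `N(t_j, 1/n)` for `j < k_0` and point masses at `0` beyond, with `t` the truncation
of `θ*` to `k_0` entries.

Bayes' formula (`posterior_eq_sum`) gives the posterior the prior density `w(Y)` times the
likelihood ratio against `P_t`. The divergence of the reference law contributes `-log w` and the
exponential moment `+log w`, so the evidence cancels and needs no lower bound. What remains is a
complexity term free of `Y` (`klDiv_referenceLaw_le`) and `log X(Y)`, where `X` is the exponentially
reweighted evidence. Since `log X ≤ 4 log c + (4/c) X^{1/4}`, it suffices that `E X^{1/4} ≤ c` under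
`P_{θ*}`.

The power `1/4` is subadditive over the models, and within one model `X` is at most a product over
coordinates. By `lintegral_mixture_rpow_le` each active coordinate costs at most a factor `exp(8a +
n (θ*_j - t_j)²)`, whatever its prior law. The resulting `exp(8ak)` is beaten by the exponential
tail of `π`, leaving `log c = O(k_0 + n ‖θ* - t‖² + 1)`.

With `x = (n / log n)^{1/(2α+1)}` one has `n x^{-2α} = x log n`, so bias, complexity and `log c` are
all `O(x log n)`; division by `a n` gives the rate. Minimality holds only almost surely for the
marginal law of the data. It transfers to `P_{θ*}` because square-summable shifts give absolutely
continuous laws and the prior lives on finitely supported sequences. -/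

namespace GaussianSequence

/-! ### Densities on infinite product measures -/

section ProductMeasures

variable {ι : Type*} {X : ι → Type*} [∀ i, MeasurableSpace (X i)]

theorem lintegral_infinitePi_prod (μ : ∀ i, Measure (X i)) [∀ i, IsProbabilityMeasure (μ i)]
    (s : Finset ι) (f : ∀ i, X i → ℝ≥0∞) (hf : ∀ i, Measurable (f i)) :
    ∫⁻ x, ∏ i ∈ s, f i (x i) ∂(Measure.infinitePi μ) = ∏ i ∈ s, ∫⁻ y, f i y ∂(μ i) := by
  have hindep : iIndepFun (fun i (x : ∀ i, X i) => f i (x i)) (Measure.infinitePi μ) :=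
    iIndepFun_infinitePi hf
  rw [lintegral_prod_eq_prod_lintegral_of_indepFun s _ hindep
    fun i => (hf i).comp (measurable_pi_apply i)]
  refine Finset.prod_congr rfl fun i _ => ?_
  rw [← Measure.infinitePi_map_eval μ i, lintegral_map (hf i) (by fun_prop)]

/-- Changing finitely many factors of a product measure by densities. -/
theorem infinitePi_eq_withDensity_prod (μ ν : ∀ i, Measure (X i))
    [∀ i, IsProbabilityMeasure (μ i)] [∀ i, IsProbabilityMeasure (ν i)]
    (s : Finset ι) (f : ∀ i, X i → ℝ≥0∞) (hf : ∀ i, Measurable (f i))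
    (hs : ∀ i ∈ s, ν i = (μ i).withDensity (f i)) (hs' : ∀ i ∉ s, ν i = μ i) :
    Measure.infinitePi ν = (Measure.infinitePi μ).withDensity fun x => ∏ i ∈ s, f i (x i) := by
  classical
  refine (Measure.eq_infinitePi ν fun u t ht => ?_).symm
  have hmeas : MeasurableSet (Set.pi (u : Set ι) t) :=
    MeasurableSet.pi u.countable_toSet fun i _ => ht i
  rw [withDensity_apply _ hmeas, ← lintegral_indicator hmeas]
  let F : ∀ i, X i → ℝ≥0∞ := fun i x =>
    (if i ∈ s then f i x else 1) * (if i ∈ u then (t i).indicator 1 x else 1)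
  have hF : ∀ i, Measurable (F i) := fun i => by
    refine Measurable.mul ?_ ?_
    · split_ifs
      exacts [hf i, measurable_const]
    · split_ifs
      exacts [measurable_one.indicator (ht i), measurable_const]
  have hint : ∀ i, ∫⁻ y, F i y ∂(μ i) = if i ∈ u then ν i (t i) else 1 := fun i => by
    by_cases his : i ∈ s <;> by_cases hiu : i ∈ u
    · simp only [F, his, hiu, if_true]
      rw [hs i his, withDensity_apply _ (ht i), ← lintegral_indicator (ht i)]
      refine lintegral_congr fun y => ?_
      by_cases hy : y ∈ t i <;> simp [hy]
    · simp only [F, his, hiu, if_true, if_false, mul_one]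
      have := measure_univ (μ := ν i)
      rwa [hs i his, withDensity_apply _ MeasurableSet.univ, setLIntegral_univ] at this
    · simp only [F, his, hiu, if_true, if_false, one_mul]
      rw [lintegral_indicator_one (ht i), hs' i his]
    · simp [F, his, hiu]
  have hprod : ∀ x : ∀ i, X i, (Set.pi (u : Set ι) t).indicator
      (fun x => ∏ i ∈ s, f i (x i)) x = ∏ i ∈ s ∪ u, F i (x i) := fun x => by
    simp only [F, Finset.prod_mul_distrib, Finset.prod_ite_mem,
      Finset.union_inter_cancel_left, Finset.union_inter_cancel_right]
    by_cases hx : x ∈ Set.pi (u : Set ι) t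
    · rw [Set.indicator_of_mem hx, Finset.prod_eq_one (s := u)
        fun i hi => Set.indicator_of_mem (hx i hi) 1, mul_one]
    · rw [Set.indicator_of_notMem hx]
      simp only [Set.mem_pi, not_forall] at hx
      obtain ⟨i, hi, hxi⟩ := hx
      rw [Finset.prod_eq_zero (i := i) hi (Set.indicator_of_notMem hxi 1), mul_zero]
  simp_rw [hprod]
  rw [lintegral_infinitePi_prod μ _ F hF]
  simp_rw [hint, Finset.prod_ite_mem, Finset.union_inter_cancel_right]

end ProductMeasures

/-! ### Absolute continuity from an algebra of sets -/

/-- A domination on a generating algebra that forces absolute continuity. -/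
theorem absolutelyContinuous_of_sq_le {X : Type*} [m : MeasurableSpace X] {μ ν : Measure X}
    [IsFiniteMeasure μ] [IsFiniteMeasure ν] {𝒜 : Set (Set X)} (h𝒜 : IsSetAlgebra 𝒜)
    (hgen : m = MeasurableSpace.generateFrom 𝒜) (C : ℝ)
    (h : ∀ A ∈ 𝒜, μ.real A ^ 2 ≤ C * ν.real A) : μ ≪ ν := by
  have hC : 0 ≤ C ∨ ν.real Set.univ = 0 := by
    by_contra! hcon
    have h1 := h _ h𝒜.univ_mem
    have h2 : 0 ≤ ν.real Set.univ := measureReal_nonneg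
    nlinarith [sq_nonneg (μ.real Set.univ), lt_of_le_of_ne h2 (Ne.symm hcon.2)]
  have hνle : ∀ A, C * ν.real A ≤ |C| * ν.real A := fun A =>
    mul_le_mul_of_nonneg_right (le_abs_self C) measureReal_nonneg
  refine Measure.AbsolutelyContinuous.mk fun s hs hνs => ?_
  -- Approximating a `ν`-null `s` by `t ∈ 𝒜` for the sum `μ + ν` makes both symmetric differences
  -- small at once. Then `ν t ≤ ε`, and the hypothesis on `t` bounds `μ t`.
  have hdense := Measure.MeasureDense.of_generateFrom_isSetAlgebra_finite (μ := μ + ν) h𝒜 hgen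
  have key : ∀ ε : ℝ, 0 < ε → μ.real s ≤ √(|C| * ε) + ε := by
    intro ε hε
    obtain ⟨t, ht, hst⟩ := hdense.approx s hs (measure_ne_top _ _) ε hε
    have htm : MeasurableSet t := hdense.measurable t ht
    rw [Measure.add_apply] at hst
    have hμd : μ.real (symmDiff s t) ≤ ε := by
      refine ENNReal.toReal_le_of_le_ofReal hε.le (le_trans le_self_add hst.le)
    have hνd : ν.real (symmDiff s t) ≤ ε :=
      ENNReal.toReal_le_of_le_ofReal hε.le (le_trans le_add_self hst.le)
    have hνt : ν.real t ≤ ε := by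
      have h1 : ν.real t ≤ ν.real (s ∪ symmDiff s t) := by
        refine measureReal_mono ?_
        intro x hx
        by_cases hxs : x ∈ s
        · exact Or.inl hxs
        · exact Or.inr (Or.inr ⟨hx, hxs⟩)
      have h2 := measureReal_union_le (μ := ν) s (symmDiff s t)
      have h3 : ν.real s = 0 := by simp [measureReal_def, hνs]
      linarith
    have hμt : μ.real t ≤ √(|C| * ε) := by
      refine Real.le_sqrt_of_sq_le ((h t ht).trans ((hνle t).trans ?_))
      exact mul_le_mul_of_nonneg_left hνt (abs_nonneg C)
    have h1 : μ.real s ≤ μ.real (t ∪ symmDiff s t) := by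
      refine measureReal_mono ?_
      intro x hx
      by_cases hxt : x ∈ t
      · exact Or.inl hxt
      · exact Or.inr (Or.inl ⟨hx, hxt⟩)
    have h2 := measureReal_union_le (μ := μ) t (symmDiff s t)
    linarith
  have hlim : Filter.Tendsto (fun ε : ℝ => √(|C| * ε) + ε) (nhdsWithin 0 (Set.Ioi 0)) (nhds 0) := by
    have : Continuous fun ε : ℝ => √(|C| * ε) + ε := by fun_prop
    have h0 := this.tendsto 0
    simp only [mul_zero, Real.sqrt_zero, add_zero] at h0
    exact h0.mono_left nhdsWithin_le_nhds
  have hle : μ.real s ≤ 0 :=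
    ge_of_tendsto hlim (Filter.eventually_of_mem self_mem_nhdsWithin fun ε hε => key ε hε)
  have h0 : μ.real s = 0 := le_antisymm hle measureReal_nonneg
  exact (measureReal_eq_zero_iff (measure_ne_top _ _)).1 h0

/-! ### Entropy inequalities -/

section KullbackLeibler

variable {X : Type*} [MeasurableSpace X]

/-- Fenchel–Young inequality for `x log x + 1 - x`. -/
theorem mul_le_klFun_add_exp {x : ℝ} (hx : 0 ≤ x) (y : ℝ) :
    x * y + 1 ≤ klFun x + Real.exp y := by
  rw [klFun_apply]
  rcases hx.eq_or_lt with rfl | hx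
  · simp [(Real.exp_pos y).le]
  · have h1 := Real.add_one_le_exp (y - Real.log x)
    rw [Real.exp_sub, Real.exp_log hx, le_div_iff₀ hx] at h1
    nlinarith

/-- The variational (Donsker–Varadhan) inequality for a nonnegative function. -/
theorem lintegral_le_klDiv_add_log {Q μ : Measure X} [IsProbabilityMeasure Q]
    [IsProbabilityMeasure μ] {f : X → ℝ} (hf : Measurable f) (hf0 : ∀ x, 0 ≤ f x)
    {F : ℝ} (hF : 1 ≤ F) (hFint : ∫⁻ x, ENNReal.ofReal (Real.exp (f x)) ∂μ ≤ ENNReal.ofReal F) :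
    ∫⁻ x, ENNReal.ofReal (f x) ∂Q ≤ klDiv Q μ + ENNReal.ofReal (Real.log F) := by
  by_cases hac : Q ≪ μ
  swap
  · simp [klDiv_of_not_ac hac]
  have hF0 : 0 < F := by linarith
  have hlog : 0 ≤ Real.log F := Real.log_nonneg hF
  set r : X → ℝ≥0∞ := Q.rnDeriv μ
  have hr : Measurable r := Measure.measurable_rnDeriv Q μ
  -- Fenchel–Young at the density `r` and `f - log F`. The term `r log F` is moved to the right so
  -- that every term is nonnegative, and the integrated inequality makes sense in `ℝ≥0∞` even when
  -- the divergence is infinite.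
  have hpt : ∀ᵐ x ∂μ, r x * ENNReal.ofReal (f x) + 1 ≤
      ENNReal.ofReal (klFun (r x).toReal) + ENNReal.ofReal (Real.log F) * r x
        + ENNReal.ofReal F⁻¹ * ENNReal.ofReal (Real.exp (f x)) := by
    filter_upwards [Measure.rnDeriv_lt_top Q μ] with x hx
    have h0 : 0 ≤ (r x).toReal := ENNReal.toReal_nonneg
    have hk := klFun_nonneg h0
    have hy := mul_le_klFun_add_exp h0 (f x - Real.log F)
    rw [Real.exp_sub, Real.exp_log hF0] at hy
    have hrx : r x = ENNReal.ofReal (r x).toReal := (ENNReal.ofReal_toReal hx.ne).symm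
    rw [hrx, ENNReal.toReal_ofReal h0, ← ENNReal.ofReal_mul h0, ← ENNReal.ofReal_mul hlog,
      ← ENNReal.ofReal_mul (by positivity), ← ENNReal.ofReal_one,
      ← ENNReal.ofReal_add (mul_nonneg h0 (hf0 x)) zero_le_one,
      ← ENNReal.ofReal_add hk (by positivity), ← ENNReal.ofReal_add (by positivity) (by positivity)]
    refine ENNReal.ofReal_le_ofReal ?_
    rw [div_eq_inv_mul] at hy
    linarith
  have hr1 : ∫⁻ x, r x ∂μ = 1 := by
    rw [Measure.lintegral_rnDeriv hac, measure_univ]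
  have hint := lintegral_mono_ae hpt
  have hmk : Measurable fun x => ENNReal.ofReal (klFun (r x).toReal) :=
    (measurable_klFun.comp hr.ennreal_toReal).ennreal_ofReal
  have hmk2 : Measurable fun x =>
      ENNReal.ofReal (klFun (r x).toReal) + ENNReal.ofReal (Real.log F) * r x :=
    hmk.add (hr.const_mul _)
  rw [lintegral_add_right _ measurable_const,
    lintegral_add_left hmk2, lintegral_add_left hmk,
    lintegral_const_mul _ hr, lintegral_const_mul _ hf.exp.ennreal_ofReal, hr1,
    lintegral_rnDeriv_mul hac hf.ennreal_ofReal.aemeasurable,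
    ← klDiv_eq_lintegral_klFun_of_ac hac, lintegral_const, measure_univ, mul_one, mul_one] at hint
  have hlast : ENNReal.ofReal F⁻¹ * ∫⁻ x, ENNReal.ofReal (Real.exp (f x)) ∂μ ≤ 1 := by
    refine (mul_le_mul_right hFint _).trans ?_
    rw [← ENNReal.ofReal_mul (by positivity), inv_mul_cancel₀ hF0.ne', ENNReal.ofReal_one]
  exact (ENNReal.add_le_add_iff_right ENNReal.one_ne_top).1 (hint.trans (by gcongr))

/-- If `dQ ≤ e^U dμ` then `D(Q ‖ μ) ≤ ∫ U dQ`. -/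
theorem klDiv_le_of_le_withDensity_exp {Q μ : Measure X} [IsProbabilityMeasure Q]
    [IsProbabilityMeasure μ] {U : X → ℝ} (hUint : Integrable U Q)
    (hle : Q ≤ μ.withDensity fun x => ENNReal.ofReal (Real.exp (U x))) :
    0 ≤ ∫ x, U x ∂Q ∧ klDiv Q μ ≤ ENNReal.ofReal (∫ x, U x ∂Q) := by
  have hac : Q ≪ μ :=
    (Measure.absolutelyContinuous_of_le hle).trans (withDensity_absolutelyContinuous _ _)
  set r : X → ℝ≥0∞ := Q.rnDeriv μ
  have hr : Measurable r := Measure.measurable_rnDeriv Q μ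
  have hrle : r ≤ᵐ[μ] fun x => ENNReal.ofReal (Real.exp (U x)) := by
    refine ae_le_of_forall_setLIntegral_le_of_sigmaFinite hr fun s hs _ => ?_
    rw [Measure.setLIntegral_rnDeriv hac, ← withDensity_apply _ hs]
    exact hle s
  -- From `log r ≤ U`. As `klFun` is nonnegative, so is the right-hand side, whose integral is `∫ U
  -- dQ`; this also gives the first conclusion.
  have hpt : ∀ᵐ x ∂μ, klFun (r x).toReal ≤ (r x).toReal * U x + 1 - (r x).toReal := by
    filter_upwards [hrle] with x hx
    rw [klFun_apply]
    have h0 : 0 ≤ (r x).toReal := ENNReal.toReal_nonneg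
    have hx' : (r x).toReal ≤ Real.exp (U x) :=
      ENNReal.toReal_le_of_le_ofReal (Real.exp_pos _).le hx
    rcases h0.eq_or_lt with h | h
    · simp [← h]
    · have := (Real.log_le_iff_le_exp h).2 hx'
      nlinarith
  have hint1 : Integrable (fun x => (r x).toReal * U x) μ :=
    (integrable_rnDeriv_smul_iff hac).2 hUint
  have hint2 : Integrable (fun x => (r x).toReal) μ := Measure.integrable_toReal_rnDeriv
  have hint3 : Integrable (fun x => (r x).toReal * U x + 1) μ := hint1.add (integrable_const 1)
  have hint : Integrable (fun x => (r x).toReal * U x + 1 - (r x).toReal) μ := hint3.sub hint2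
  have hval : ∫ x, ((r x).toReal * U x + 1 - (r x).toReal) ∂μ = ∫ x, U x ∂Q := by
    have h1 : ∫ x, (r x).toReal * U x ∂μ = ∫ x, U x ∂Q := integral_rnDeriv_smul hac
    have h2 : ∫ x, (r x).toReal ∂μ = 1 := by
      rw [Measure.integral_toReal_rnDeriv hac, probReal_univ]
    rw [integral_sub hint3 hint2,
      integral_add hint1 (integrable_const 1), h1, h2]
    simp
  have hnonneg : 0 ≤ᵐ[μ] fun x => (r x).toReal * U x + 1 - (r x).toReal := by
    filter_upwards [hpt] with x hx
    exact (klFun_nonneg ENNReal.toReal_nonneg).trans hx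
  refine ⟨hval ▸ integral_nonneg_of_ae hnonneg, ?_⟩
  rw [klDiv_eq_lintegral_klFun_of_ac hac, ← hval,
    ofReal_integral_eq_lintegral_ofReal hint hnonneg]
  exact lintegral_mono_ae (hpt.mono fun x hx => ENNReal.ofReal_le_ofReal hx)

end KullbackLeibler

/-! ### One-dimensional Gaussian moments -/

/-- The density of `N(x, v)` with respect to `N(t, v)`. -/
noncomputable def gaussianRatio (v : ℝ≥0) (t x y : ℝ) : ℝ :=
  Real.exp (((x - t) * (y - t) - (x - t) ^ 2 / 2) / v)

theorem gaussianRatio_pos (v : ℝ≥0) (t x y : ℝ) : 0 < gaussianRatio v t x y := Real.exp_pos _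

@[simp] theorem gaussianRatio_self (v : ℝ≥0) (t y : ℝ) : gaussianRatio v t t y = 1 := by
  simp [gaussianRatio]

@[fun_prop]
theorem measurable_gaussianRatio {X : Type*} [MeasurableSpace X] (v : ℝ≥0) (t : ℝ) {f g : X → ℝ}
    (hf : Measurable f) (hg : Measurable g) : Measurable fun x => gaussianRatio v t (f x) (g x) := by
  unfold gaussianRatio
  fun_prop

theorem gaussianReal_eq_withDensity_gaussianRatio {v : ℝ≥0} (hv : v ≠ 0) (t x : ℝ) :
    gaussianReal x v =
      (gaussianReal t v).withDensity fun y => ENNReal.ofReal (gaussianRatio v t x y) := by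
  rw [gaussianReal_of_var_ne_zero t hv, gaussianReal_of_var_ne_zero x hv,
    ← withDensity_mul _ (measurable_gaussianPDF t v) (by fun_prop)]
  congr 1
  ext y
  simp only [Pi.mul_apply, gaussianPDF]
  rw [← ENNReal.ofReal_mul (gaussianPDFReal_nonneg _ _ _)]
  congr 1
  simp only [gaussianPDFReal, gaussianRatio]
  rw [mul_assoc _ (Real.exp _), ← Real.exp_add]
  congr 2
  have : (v : ℝ) ≠ 0 := by exact_mod_cast hv
  field_simp
  ring

theorem lintegral_gaussianRatio {v : ℝ≥0} (hv : v ≠ 0) (t x : ℝ) :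
    ∫⁻ y, ENNReal.ofReal (gaussianRatio v t x y) ∂(gaussianReal t v) = 1 := by
  have h := measure_univ (μ := gaussianReal x v)
  rwa [gaussianReal_eq_withDensity_gaussianRatio hv t x, withDensity_apply _ MeasurableSet.univ,
    setLIntegral_univ] at h

/-- The square of the ratio is a constant times the ratio for the mean `2x - t`, and that ratio
integrates to one. -/
theorem lintegral_gaussianRatio_sq {v : ℝ≥0} (hv : v ≠ 0) (t x : ℝ) :
    ∫⁻ y, ENNReal.ofReal (gaussianRatio v t x y ^ 2) ∂(gaussianReal t v) =
      ENNReal.ofReal (Real.exp ((x - t) ^ 2 / v)) := by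
  have hsq : ∀ y, gaussianRatio v t x y ^ 2 =
      Real.exp ((x - t) ^ 2 / v) * gaussianRatio v t (2 * x - t) y := fun y => by
    simp only [gaussianRatio, ← Real.exp_add, ← Real.exp_nat_mul]
    congr 1
    push_cast
    ring
  simp_rw [hsq, ENNReal.ofReal_mul (Real.exp_pos _).le]
  rw [lintegral_const_mul _ (by fun_prop), lintegral_gaussianRatio hv, mul_one]

/-- The weight turns the `N(t, v)` density into `√2` times the `N(t, 2v)` density. -/
theorem lintegral_exp_sq_gaussianReal_le {v : ℝ≥0} (hv : v ≠ 0) (t : ℝ) :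
    ∫⁻ y, ENNReal.ofReal (Real.exp ((y - t) ^ 2 / v / 4)) ∂(gaussianReal t v) ≤ 2 := by
  have hv0 : (0 : ℝ) < v := by positivity
  rw [gaussianReal_of_var_ne_zero t hv,
    lintegral_withDensity_eq_lintegral_mul _ (measurable_gaussianPDF t v) (by fun_prop)]
  have hpdf : ∀ y, (gaussianPDF t v * fun y => ENNReal.ofReal (Real.exp ((y - t) ^ 2 / v / 4))) y =
      ENNReal.ofReal √2 * gaussianPDF t (2 * v) y := fun y => by
    simp only [Pi.mul_apply, gaussianPDF]
    rw [← ENNReal.ofReal_mul (gaussianPDFReal_nonneg _ _ _), ← ENNReal.ofReal_mul (by positivity)]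
    congr 1
    simp only [gaussianPDFReal, NNReal.coe_mul, NNReal.coe_ofNat]
    have h2 : √(2 * Real.pi * (2 * v)) = √2 * √(2 * Real.pi * v) := by
      rw [← Real.sqrt_mul (by norm_num)]
      congr 1
      ring
    rw [h2, mul_inv, mul_assoc, ← Real.exp_add, ← mul_assoc, ← mul_assoc,
      mul_inv_cancel₀ (by positivity), one_mul]
    congr 2
    field_simp
    ring
  simp_rw [hpdf]
  rw [lintegral_const_mul _ (measurable_gaussianPDF _ _),
    lintegral_gaussianPDF_eq_one t (by positivity), mul_one]
  simp

theorem exp_mul_le_affine {s : ℝ} (hs0 : 0 ≤ s) (hs1 : s ≤ 1) (w : ℝ) :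
    Real.exp (s * w) ≤ (1 - s) + s * Real.exp w := by
  have := convexOn_exp.2 (Set.mem_univ (0 : ℝ)) (Set.mem_univ w) (sub_nonneg.2 hs1) hs0 (by ring)
  simpa using this

/-- Convexity interpolates between the weights `1` and `exp(z²/4)`, so the bound tends to one as `a
→ 0`. This matters because such factors are multiplied over many coordinates. -/
theorem lintegral_exp_mul_sq_gaussianReal_le {v : ℝ≥0} (hv : v ≠ 0) (t : ℝ) {a : ℝ} (ha : 0 ≤ a)
    (ha' : 4 * a ≤ 1) :
    ∫⁻ y, ENNReal.ofReal (Real.exp (a * ((y - t) ^ 2 / v))) ∂(gaussianReal t v) ≤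
      ENNReal.ofReal (Real.exp (4 * a)) := by
  calc ∫⁻ y, ENNReal.ofReal (Real.exp (a * ((y - t) ^ 2 / v))) ∂(gaussianReal t v)
      ≤ ∫⁻ y, (ENNReal.ofReal (1 - 4 * a) + ENNReal.ofReal (4 * a) *
          ENNReal.ofReal (Real.exp ((y - t) ^ 2 / v / 4))) ∂(gaussianReal t v) := by
        refine lintegral_mono fun y => ?_
        rw [← ENNReal.ofReal_mul (by positivity), ← ENNReal.ofReal_add (by linarith) (by positivity)]
        refine ENNReal.ofReal_le_ofReal ?_
        have := exp_mul_le_affine (by positivity) ha' ((y - t) ^ 2 / v / 4)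
        refine le_trans (le_of_eq ?_) this
        congr 1
        ring
    _ ≤ ENNReal.ofReal (1 - 4 * a) + ENNReal.ofReal (4 * a) * 2 := by
        rw [lintegral_add_left measurable_const, lintegral_const, measure_univ, mul_one,
          lintegral_const_mul _ (by fun_prop)]
        gcongr
        exact lintegral_exp_sq_gaussianReal_le hv t
    _ ≤ ENNReal.ofReal (Real.exp (4 * a)) := by
        have h2 : (2 : ℝ≥0∞) = ENNReal.ofReal 2 := by simp
        rw [h2, ← ENNReal.ofReal_mul (by positivity),
          ← ENNReal.ofReal_add (by linarith) (by positivity)]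
        refine ENNReal.ofReal_le_ofReal ?_
        linarith [Real.add_one_le_exp (4 * a)]

/-- A fraction `8a` of the log-likelihood ratio contains `-4a (x - t)²`, which absorbs the growth of
the weight in `x` at the price of a factor in `y`. The remaining power `1 - 8a` is linearized by
convexity, and the last factor then has mean one under `N(t, v)` for every `x`. Hence no assumption
on the law of `x` is needed later. -/
theorem exp_mul_sq_mul_gaussianRatio_le {v : ℝ≥0} (hv : v ≠ 0) {a : ℝ} (ha : 0 ≤ a)
    (ha' : 8 * a ≤ 1) (θ t x y : ℝ) :
    Real.exp (a * ((x - θ) ^ 2 / v)) * gaussianRatio v t x y ≤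
      Real.exp (2 * a * ((θ - t) ^ 2 / v)) * Real.exp (8 * a * ((y - t) ^ 2 / v)) *
        (8 * a + (1 - 8 * a) * gaussianRatio v t x y) := by
  have hv0 : (0 : ℝ) < v := by positivity
  have h1 := exp_mul_le_affine (s := 1 - 8 * a) (by linarith) (by linarith)
    (((x - t) * (y - t) - (x - t) ^ 2 / 2) / v)
  rw [sub_sub_cancel] at h1
  refine le_trans ?_ (mul_le_mul_of_nonneg_left h1 (by positivity))
  rw [gaussianRatio, ← Real.exp_add, ← Real.exp_add, ← Real.exp_add]
  refine Real.exp_le_exp.2 ?_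
  have hkey : a * (x - θ) ^ 2 + ((x - t) * (y - t) - (x - t) ^ 2 / 2) ≤
      2 * a * (θ - t) ^ 2 + 8 * a * (y - t) ^ 2 +
        (1 - 8 * a) * ((x - t) * (y - t) - (x - t) ^ 2 / 2) := by
    have e1 := mul_nonneg ha (sq_nonneg ((x - t) + (θ - t)))
    have e2 := mul_nonneg ha (sq_nonneg ((x - t) - 2 * (y - t)))
    linarith
  calc _ = (a * (x - θ) ^ 2 + ((x - t) * (y - t) - (x - t) ^ 2 / 2)) / v := by ring
    _ ≤ _ := div_le_div_of_nonneg_right hkey hv0.le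
    _ = _ := by ring

/-- The fractional moment of an exponentially reweighted one-dimensional mixture likelihood ratio
is close to one when the weight is small. -/
theorem lintegral_mixture_rpow_le {v : ℝ≥0} (hv : v ≠ 0) {a : ℝ} (ha : 0 ≤ a) (ha' : 32 * a ≤ 1)
    (θ t : ℝ) (ν : Measure ℝ) [IsProbabilityMeasure ν] :
    ∫⁻ y, (∫⁻ x, ENNReal.ofReal (Real.exp (a * ((x - θ) ^ 2 / v)) * gaussianRatio v t x y) ∂ν)
        ^ (1 / 4 : ℝ) ∂(gaussianReal θ v) ≤
      ENNReal.ofReal (Real.exp (8 * a + (θ - t) ^ 2 / v)) := by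
  have hv0 : (0 : ℝ) < v := by positivity
  set B : ℝ → ℝ≥0∞ := fun y => ∫⁻ x, ENNReal.ofReal (8 * a + (1 - 8 * a) * gaussianRatio v t x y) ∂ν
  have hB : Measurable B := by
    refine Measurable.lintegral_prod_left' (f := fun p : ℝ × ℝ =>
      ENNReal.ofReal (8 * a + (1 - 8 * a) * gaussianRatio v t p.1 p.2)) ?_
    fun_prop
  have hBint : ∫⁻ y, B y ∂(gaussianReal t v) = 1 := by
    simp only [B]
    rw [lintegral_lintegral_swap (by
      refine Measurable.aemeasurable ?_
      simp only [Function.uncurry_def]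
      fun_prop)]
    have : ∀ x, ∫⁻ y, ENNReal.ofReal (8 * a + (1 - 8 * a) * gaussianRatio v t x y)
        ∂(gaussianReal t v) = 1 := fun x => by
      have h8 : 0 ≤ 1 - 8 * a := by linarith
      simp_rw [ENNReal.ofReal_add (show 0 ≤ 8 * a by positivity)
        (mul_nonneg h8 (gaussianRatio_pos v t x _).le), ENNReal.ofReal_mul h8]
      rw [lintegral_add_left measurable_const, lintegral_const, measure_univ, mul_one,
        lintegral_const_mul _ (by fun_prop), lintegral_gaussianRatio hv, mul_one,
        ← ENNReal.ofReal_add (by positivity) h8]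
      simp
    simp [this]
  have hinner : ∀ y,
      ∫⁻ x, ENNReal.ofReal (Real.exp (a * ((x - θ) ^ 2 / v)) * gaussianRatio v t x y) ∂ν ≤
        ENNReal.ofReal (Real.exp (2 * a * ((θ - t) ^ 2 / v))) *
          ENNReal.ofReal (Real.exp (8 * a * ((y - t) ^ 2 / v))) * B y := fun y => by
    rw [← ENNReal.ofReal_mul (by positivity), ← lintegral_const_mul _ (by fun_prop)]
    refine lintegral_mono fun x => ?_
    rw [← ENNReal.ofReal_mul (by positivity)]
    exact ENNReal.ofReal_le_ofReal
      (exp_mul_sq_mul_gaussianRatio_le hv ha (by linarith) θ t x y)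
  set δ : ℝ := (θ - t) ^ 2 / v
  have hδ : 0 ≤ δ := by positivity
  -- Hölder with exponents `1/2, 1/4, 1/4`: the change of measure from `N(θ, v)` to `N(t, v)` uses a
  -- second moment, and the quarter power is split between the weight in `y` and the mean-one
  -- mixture `B`. This is the origin of the exponent `1/4`.
  let f : Fin 3 → ℝ → ℝ≥0∞ := ![fun y => ENNReal.ofReal (gaussianRatio v t θ y ^ 2),
    fun y => ENNReal.ofReal (Real.exp (8 * a * ((y - t) ^ 2 / v))), B]
  let p : Fin 3 → ℝ := ![1 / 2, 1 / 4, 1 / 4]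
  have holder := ENNReal.lintegral_prod_norm_pow_le (μ := gaussianReal t v) Finset.univ
    (f := f) (p := p) (by
      intro i _
      fin_cases i
      · have : Measurable fun y => ENNReal.ofReal (gaussianRatio v t θ y ^ 2) := by fun_prop
        exact this.aemeasurable
      · have : Measurable fun y => ENNReal.ofReal (Real.exp (8 * a * ((y - t) ^ 2 / v))) := by
          fun_prop
        exact this.aemeasurable
      · exact hB.aemeasurable) (by simp [p, Fin.sum_univ_three]; norm_num) (by
      intro i _
      fin_cases i <;> simp [p])
  simp only [Fin.prod_univ_three, f, p, Matrix.cons_val_zero, Matrix.cons_val_one,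
    Matrix.cons_val] at holder
  rw [lintegral_gaussianRatio_sq hv, hBint, ENNReal.one_rpow, mul_one] at holder
  have hmid := lintegral_exp_mul_sq_gaussianReal_le hv t (a := 8 * a) (by positivity) (by linarith)
  have hexp : ∀ w c : ℝ, ENNReal.ofReal (Real.exp w) ^ c = ENNReal.ofReal (Real.exp (w * c)) :=
    fun w c => by rw [ENNReal.ofReal_rpow_of_pos (Real.exp_pos _), ← Real.exp_mul]
  calc _ ≤ ∫⁻ y, (ENNReal.ofReal (Real.exp (2 * a * δ)) *
          ENNReal.ofReal (Real.exp (8 * a * ((y - t) ^ 2 / v))) * B y) ^ (1 / 4 : ℝ)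
          ∂(gaussianReal θ v) :=
        lintegral_mono fun y => ENNReal.rpow_le_rpow (hinner y) (by norm_num)
    _ = ENNReal.ofReal (Real.exp (2 * a * δ)) ^ (1 / 4 : ℝ) *
          ∫⁻ y, ENNReal.ofReal (gaussianRatio v t θ y ^ 2) ^ (1 / 2 : ℝ) *
            ENNReal.ofReal (Real.exp (8 * a * ((y - t) ^ 2 / v))) ^ (1 / 4 : ℝ) *
            B y ^ (1 / 4 : ℝ) ∂(gaussianReal t v) := by
        rw [gaussianReal_eq_withDensity_gaussianRatio hv t θ,
          lintegral_withDensity_eq_lintegral_mul _ (by fun_prop) (by fun_prop),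
          ← lintegral_const_mul _ (by fun_prop)]
        refine lintegral_congr fun y => ?_
        have h1 : ENNReal.ofReal (gaussianRatio v t θ y ^ 2) ^ (1 / 2 : ℝ) =
            ENNReal.ofReal (gaussianRatio v t θ y) := by
          rw [ENNReal.ofReal_rpow_of_nonneg (by positivity) (by norm_num), ← Real.sqrt_eq_rpow,
            Real.sqrt_sq (gaussianRatio_pos _ _ _ _).le]
        simp only [Pi.mul_apply]
        rw [h1, ENNReal.mul_rpow_of_nonneg _ _ (by norm_num),
          ENNReal.mul_rpow_of_nonneg _ _ (by norm_num)]
        ring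
    _ ≤ ENNReal.ofReal (Real.exp (2 * a * δ)) ^ (1 / 4 : ℝ) *
          (ENNReal.ofReal (Real.exp δ) ^ (1 / 2 : ℝ) *
            ENNReal.ofReal (Real.exp (4 * (8 * a))) ^ (1 / 4 : ℝ)) := by
        gcongr
        exact holder.trans (by gcongr)
    _ ≤ _ := by
        rw [hexp, hexp, hexp, ← ENNReal.ofReal_mul (by positivity),
          ← ENNReal.ofReal_mul (by positivity), ← Real.exp_add, ← Real.exp_add]
        refine ENNReal.ofReal_le_ofReal (Real.exp_le_exp.2 ?_)
        -- The total coefficient of `δ` is `a/2 + 1/2`, which is below one.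
        nlinarith

/-- Cauchy–Schwarz for the density on `A`. It supplies the domination required by
`absolutelyContinuous_of_sq_le`. -/
theorem sq_withDensity_apply_le {X : Type*} [MeasurableSpace X] (ν : Measure X) {f : X → ℝ≥0∞}
    (hf : Measurable f) {A : Set X} (hA : MeasurableSet A) :
    ν.withDensity f A ^ 2 ≤ (∫⁻ x, f x ^ 2 ∂ν) * ν A := by
  have h := ENNReal.lintegral_mul_le_Lp_mul_Lq (ν.restrict A) Real.HolderConjugate.two_two
    hf.aemeasurable (g := fun _ => 1) aemeasurable_const
  simp only [Pi.mul_apply, mul_one, lintegral_const, Measure.restrict_apply_univ,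
    ENNReal.rpow_two, one_pow, one_mul] at h
  rw [withDensity_apply _ hA]
  have hsq : ∀ x : ℝ≥0∞, (x ^ (1 / 2 : ℝ)) ^ 2 = x := fun x => by
    rw [← ENNReal.rpow_two, ← ENNReal.rpow_mul]
    norm_num
  calc _ ≤ ((∫⁻ x in A, f x ^ 2 ∂ν) ^ (1 / 2 : ℝ) * ν A ^ (1 / 2 : ℝ)) ^ 2 := by gcongr
    _ = (∫⁻ x in A, f x ^ 2 ∂ν) * ν A := by rw [mul_pow, hsq, hsq]
    _ ≤ _ := by
      gcongr
      exact Measure.restrict_le_self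

/-! ### Absolute continuity in the sequence model -/

section SeqLaw

variable {n : ℕ}

theorem seqLaw_eq_withDensity (hn : n ≠ 0) {θ t : ℕ → ℝ} {m : ℕ} (h : ∀ j, m ≤ j → θ j = t j) :
    seqLaw n θ = (seqLaw n t).withDensity fun Y =>
      ∏ j ∈ Finset.range m, ENNReal.ofReal (gaussianRatio (n : ℝ≥0)⁻¹ (t j) (θ j) (Y j)) := by
  have hv : (n : ℝ≥0)⁻¹ ≠ 0 := by simpa using hn
  unfold seqLaw
  refine infinitePi_eq_withDensity_prod _ _ (Finset.range m)
    (fun j y => ENNReal.ofReal (gaussianRatio (n : ℝ≥0)⁻¹ (t j) (θ j) y))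
    (fun j => by fun_prop) (fun j _ => gaussianReal_eq_withDensity_gaussianRatio hv _ _) ?_
  intro j hj
  rw [h j (by simpa using hj)]

/-- One direction of Kakutani's dichotomy. A cylinder sees finitely many coordinates, so `θ` may be
replaced by a sequence equal to `θ'` beyond `m`; its density has second moment at most `exp(n ∑ (θ_j
- θ'_j)²)`, uniformly in `m`. -/
theorem seqLaw_absolutelyContinuous (hn : n ≠ 0) {θ θ' : ℕ → ℝ}
    (h : Summable fun j => (θ j - θ' j) ^ 2) : seqLaw n θ ≪ seqLaw n θ' := by
  have hv : (n : ℝ≥0)⁻¹ ≠ 0 := by simpa using hn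
  refine absolutelyContinuous_of_sq_le isSetAlgebra_measurableCylinders
    generateFrom_measurableCylinders.symm (Real.exp (n * ∑' j, (θ j - θ' j) ^ 2)) fun A hA => ?_
  obtain ⟨s, S, hS, rfl⟩ := (mem_measurableCylinders A).1 hA
  obtain ⟨m, hm⟩ := s.exists_nat_subset_range
  let θ₁ : ℕ → ℝ := fun j => if j < m then θ j else θ' j
  have heq : seqLaw n θ (cylinder s S) = seqLaw n θ₁ (cylinder s S) := by
    unfold seqLaw
    rw [Measure.infinitePi_cylinder _ hS, Measure.infinitePi_cylinder _ hS]
    congr 2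
    ext1 j
    have hj : (j : ℕ) < m := Finset.mem_range.1 (hm j.2)
    simp [θ₁, hj]
  let f : ℕ → ℝ → ℝ≥0∞ := fun j y => ENNReal.ofReal (gaussianRatio (n : ℝ≥0)⁻¹ (θ' j) (θ₁ j) y)
  have hf : Measurable fun Y : ℕ → ℝ => ∏ j ∈ Finset.range m, f j (Y j) := by
    refine Finset.measurable_fun_prod _ fun j _ => ?_
    simp only [f]
    fun_prop
  have hle := sq_withDensity_apply_le (seqLaw n θ') hf hS.cylinder
  rw [← seqLaw_eq_withDensity hn (θ := θ₁) (t := θ') (m := m)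
    fun j hj => by simp [θ₁, hj.not_gt]] at hle
  have hprod : ∫⁻ Y, (∏ j ∈ Finset.range m, f j (Y j)) ^ 2 ∂(seqLaw n θ') ≤
      ENNReal.ofReal (Real.exp (n * ∑' j, (θ j - θ' j) ^ 2)) := by
    simp_rw [← Finset.prod_pow]
    unfold seqLaw
    rw [lintegral_infinitePi_prod _ _ (fun j y => f j y ^ 2) fun j => by
      simp only [f]; fun_prop]
    simp only [f, ← ENNReal.ofReal_pow (gaussianRatio_pos _ _ _ _).le]
    simp_rw [lintegral_gaussianRatio_sq hv]
    rw [← ENNReal.ofReal_prod_of_nonneg fun _ _ => (Real.exp_pos _).le, ← Real.exp_sum]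
    refine ENNReal.ofReal_le_ofReal (Real.exp_le_exp.2 ?_)
    have : ∑ j ∈ Finset.range m, (θ₁ j - θ' j) ^ 2 / ((n : ℝ≥0)⁻¹ : ℝ≥0) =
        n * ∑ j ∈ Finset.range m, (θ j - θ' j) ^ 2 := by
      rw [Finset.mul_sum]
      refine Finset.sum_congr rfl fun j hj => ?_
      simp [θ₁, Finset.mem_range.1 hj, mul_comm]
    rw [this]
    gcongr
    exact h.sum_le_tsum _ fun _ _ => sq_nonneg _
  have hfin := hle.trans (mul_le_mul_left hprod _)
  rw [measureReal_def, measureReal_def, heq, ← ENNReal.toReal_pow]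
  refine (ENNReal.toReal_mono (ENNReal.mul_ne_top ENNReal.ofReal_ne_top (measure_ne_top _ _))
    hfin).trans (le_of_eq ?_)
  rw [ENNReal.toReal_mul, ENNReal.toReal_ofReal (Real.exp_pos _).le]

end SeqLaw

/-! ### The sieve prior, the marginal law and Bayes' formula -/

namespace SievePrior

variable (p : SievePrior)

theorem ae_coordLaw_eq_zero (k : ℕ) :
    ∀ᵐ θ ∂(Measure.infinitePi (p.coordLaw k)), ∀ j, k ≤ j → θ j = 0 := by
  rw [ae_all_iff]
  intro j
  by_cases hj : k ≤ j
  swap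
  · simp [hj]
  have h : ∀ᵐ x ∂((Measure.infinitePi (p.coordLaw k)).map fun θ => θ j), x = 0 := by
    have := Measure.infinitePi_map_eval (p.coordLaw k) j
    rw [this]
    simp [coordLaw, hj.not_gt]
  filter_upwards [ae_of_ae_map (measurable_pi_apply j).aemeasurable h] with θ hθ _ using hθ

theorem ae_toMeasure_iff {P : (ℕ → ℝ) → Prop} :
    (∀ᵐ θ ∂p.toMeasure, P θ) ↔
      ∀ k, p.weight k ≠ 0 → ∀ᵐ θ ∂(Measure.infinitePi (p.coordLaw k)), P θ := by
  rw [toMeasure, Measure.ae_sum_iff]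
  refine forall_congr' fun k => ?_
  by_cases hk : p.weight k = 0
  · simp [hk]
  · have hpos : ENNReal.ofReal (p.weight k) ≠ 0 := by
      simpa using lt_of_le_of_ne (p.weight_nonneg k) (Ne.symm hk)
    rw [Measure.ae_ennreal_smul_measure_iff hpos]
    simp [hk]

theorem withDensity_toMeasure (f : (ℕ → ℝ) → ℝ≥0∞) :
    p.toMeasure.withDensity f = Measure.sum fun k => ENNReal.ofReal (p.weight k) •
      (Measure.infinitePi (p.coordLaw k)).withDensity f := by
  simp_rw [toMeasure, withDensity_sum, withDensity_smul_measure]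

theorem ae_toMeasure_finite_support : ∀ᵐ θ ∂p.toMeasure, ∃ k, ∀ j, k ≤ j → θ j = 0 :=
  p.ae_toMeasure_iff.2 fun k _ => (p.ae_coordLaw_eq_zero k).mono fun _ h => ⟨k, h⟩

end SievePrior

variable {n : ℕ}

theorem summable_sq_of_finite_support {θ : ℕ → ℝ} {k : ℕ} (h : ∀ j, k ≤ j → θ j = 0) :
    Summable fun j => θ j ^ 2 :=
  summable_of_ne_finset_zero (s := Finset.range k) fun j hj => by
    rw [h j (by simpa using hj)]
    simp

theorem summable_sq_sub {θ θ' : ℕ → ℝ} (h : Summable fun j => θ j ^ 2)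
    (h' : Summable fun j => θ' j ^ 2) : Summable fun j => (θ j - θ' j) ^ 2 :=
  Summable.of_nonneg_of_le (fun _ => sq_nonneg _)
    (fun j => by nlinarith [sq_nonneg (θ j + θ' j)]) ((h.add h').mul_left 2)

/-- A marginal null set is null for `P_{θ'}` for prior-almost every `θ'`, and one finitely supported
such `θ'` suffices. -/
theorem seqLaw_absolutelyContinuous_marginal (hn : n ≠ 0) (p : SievePrior) {θ : ℕ → ℝ}
    (h : Summable fun j => θ j ^ 2) : seqLaw n θ ≪ (model n) ∘ₘ p.toMeasure := by
  refine Measure.AbsolutelyContinuous.mk fun A hA hA0 => ?_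
  rw [Measure.bind_apply hA (model n).measurable.aemeasurable,
    lintegral_eq_zero_iff (Kernel.measurable_coe _ hA)] at hA0
  obtain ⟨θ', hθ', k, hk⟩ := (hA0.and p.ae_toMeasure_finite_support).exists
  exact seqLaw_absolutelyContinuous hn (summable_sq_sub h (summable_sq_of_finite_support hk)) hθ'

/-- Bayes' formula for a sieve prior, with likelihood ratios taken relative to a finitely supported
parameter `t`. -/
theorem posterior_eq_sum (hn : n ≠ 0) (p : SievePrior) {t : ℕ → ℝ} {K : ℕ}
    (ht : ∀ j, K ≤ j → t j = 0) :
    ∀ᵐ Y ∂((model n) ∘ₘ p.toMeasure), posterior (model n) p.toMeasure Y =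
      Measure.sum fun k => ENNReal.ofReal (p.weight k) •
        (Measure.infinitePi (p.coordLaw k)).withDensity fun θ =>
          (seqLaw n t).rnDeriv ((model n) ∘ₘ p.toMeasure) Y *
            ∏ j ∈ Finset.range (max k K),
              ENNReal.ofReal (gaussianRatio (n : ℝ≥0)⁻¹ (t j) (θ j) (Y j)) := by
  set marg := (model n) ∘ₘ p.toMeasure
  have hac : ∀ᵐ θ ∂p.toMeasure, model n θ ≪ marg := by
    filter_upwards [p.ae_toMeasure_finite_support] with θ ⟨k, hk⟩
    exact seqLaw_absolutelyContinuous_marginal hn p (summable_sq_of_finite_support hk)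
  have hratio : ∀ k, ∀ᵐ Y ∂marg, ∀ᵐ θ ∂(Measure.infinitePi (p.coordLaw k)),
      (model n).rnDeriv (Kernel.const _ marg) θ Y = (seqLaw n t).rnDeriv marg Y *
        ∏ j ∈ Finset.range (max k K),
          ENNReal.ofReal (gaussianRatio (n : ℝ≥0)⁻¹ (t j) (θ j) (Y j)) := by
    intro k
    -- For fixed `θ` the identity is the chain rule through `P_t`; Fubini for null sets then puts
    -- `Y` first. Beyond `max k K` both `θ` and `t` vanish, so the ratio is a finite product.
    rw [← Measure.ae_ae_comm]
    · filter_upwards [p.ae_coordLaw_eq_zero k] with θ hθ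
      have h1 : (model n).rnDeriv (Kernel.const _ marg) θ =ᵐ[marg] (model n θ).rnDeriv marg :=
        Kernel.rnDeriv_eq_rnDeriv_measure
      have hθt : ∀ j, max k K ≤ j → θ j = t j := fun j hj => by
        rw [hθ j (le_of_max_le_left hj), ht j (le_of_max_le_right hj)]
      have h2 : model n θ = (seqLaw n t).withDensity _ := seqLaw_eq_withDensity hn hθt
      have hmeas : Measurable fun Y : ℕ → ℝ => ∏ j ∈ Finset.range (max k K),
          ENNReal.ofReal (gaussianRatio (n : ℝ≥0)⁻¹ (t j) (θ j) (Y j)) :=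
        Finset.measurable_fun_prod _ fun j _ => by fun_prop
      have h3 := Measure.rnDeriv_withDensity_left (μ := seqLaw n t) (ν := marg) hmeas.aemeasurable
        (ae_of_all _ fun Y => ENNReal.prod_ne_top fun j _ => ENNReal.ofReal_ne_top)
      rw [h2] at h1
      filter_upwards [h1, h3] with Y hY1 hY3
      rw [hY1, hY3, mul_comm]
    · refine measurableSet_eq_fun ?_ ?_
      · fun_prop
      · refine Measurable.mul ?_ (Finset.measurable_fun_prod _ fun j _ => ?_)
        · exact (Measure.measurable_rnDeriv _ _).comp measurable_snd
        · fun_prop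
  filter_upwards [posterior_eq_withDensity hac, ae_all_iff.2 hratio] with Y hY hY'
  rw [hY, p.withDensity_toMeasure]
  congr 1
  ext1 k
  rw [withDensity_congr_ae (hY' k)]

/-! ### Fractional moments of the reweighted evidence -/

theorem rpow_tsum_le_tsum_rpow {ι : Type*} (f : ι → ℝ≥0∞) {r : ℝ} (hr : 0 < r) (hr1 : r ≤ 1) :
    (∑' i, f i) ^ r ≤ ∑' i, f i ^ r := by
  classical
  rw [← ENNReal.le_rpow_inv_iff hr]
  refine ENNReal.summable.tsum_le_of_sum_le fun s => ?_
  rw [ENNReal.le_rpow_inv_iff hr]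
  refine le_trans ?_ (ENNReal.sum_le_tsum s)
  induction s using Finset.induction_on with
  | empty => simp [hr]
  | insert i s hi ih =>
    rw [Finset.sum_insert hi, Finset.sum_insert hi]
    exact (ENNReal.rpow_add_le_add_rpow _ _ hr.le hr1).trans (by gcongr)

/-- The contribution of the model of dimension `k` to the integrated likelihood ratio, reweighted by
`exp (a n ∑_{j < N} (θ_j - θ*_j)²)`. -/
noncomputable def weightedEvidence (n : ℕ) (p : SievePrior) (a : ℝ) (θs t : ℕ → ℝ) (K N k : ℕ)
    (Y : ℕ → ℝ) : ℝ≥0∞ :=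
  ∫⁻ θ, ENNReal.ofReal (Real.exp (a * (n * ∑ j ∈ Finset.range N, (θ j - θs j) ^ 2))) *
    ∏ j ∈ Finset.range (max k K),
      ENNReal.ofReal (gaussianRatio (n : ℝ≥0)⁻¹ (t j) (θ j) (Y j))
    ∂(Measure.infinitePi (p.coordLaw k))

/-- Weights on further coordinates only increase the integrand, and missing likelihood factors equal
one almost surely. With a common index range the integral factorizes. -/
theorem weightedEvidence_le_prod (p : SievePrior) {a : ℝ} (ha : 0 ≤ a) (θs : ℕ → ℝ)
    {t : ℕ → ℝ} {K : ℕ} (ht : ∀ j, K ≤ j → t j = 0) (N k : ℕ) (Y : ℕ → ℝ) :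
    weightedEvidence n p a θs t K N k Y ≤ ∏ j ∈ Finset.range (max (max k K) N),
      ∫⁻ x, ENNReal.ofReal (Real.exp (a * ((x - θs j) ^ 2 / (n : ℝ≥0)⁻¹)) *
        gaussianRatio (n : ℝ≥0)⁻¹ (t j) x (Y j)) ∂(p.coordLaw k j) := by
  rw [← lintegral_infinitePi_prod (p.coordLaw k) _ (fun j x =>
    ENNReal.ofReal (Real.exp (a * ((x - θs j) ^ 2 / (n : ℝ≥0)⁻¹)) *
        gaussianRatio (n : ℝ≥0)⁻¹ (t j) x (Y j))) (fun j => by fun_prop)]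
  refine lintegral_mono_ae ?_
  filter_upwards [p.ae_coordLaw_eq_zero k] with θ hθ
  have h1 : ∏ j ∈ Finset.range (max k K),
      ENNReal.ofReal (gaussianRatio (n : ℝ≥0)⁻¹ (t j) (θ j) (Y j)) =
      ∏ j ∈ Finset.range (max (max k K) N),
        ENNReal.ofReal (gaussianRatio (n : ℝ≥0)⁻¹ (t j) (θ j) (Y j)) := by
    refine Finset.prod_subset (Finset.range_mono (le_max_left _ _)) fun j _ hj => ?_
    have hj' : max k K ≤ j := by simpa using hj
    rw [hθ j (le_of_max_le_left hj'), ht j (le_of_max_le_right hj'), gaussianRatio_self,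
      ENNReal.ofReal_one]
  rw [h1]
  simp_rw [ENNReal.ofReal_mul (Real.exp_pos _).le]
  rw [Finset.prod_mul_distrib]
  gcongr
  rw [← ENNReal.ofReal_prod_of_nonneg fun _ _ => (Real.exp_pos _).le, ← Real.exp_sum,
    ← Finset.mul_sum]
  refine ENNReal.ofReal_le_ofReal (Real.exp_le_exp.2 (mul_le_mul_of_nonneg_left ?_ ha))
  rw [Finset.mul_sum]
  refine (Finset.sum_le_sum_of_subset_of_nonneg (Finset.range_mono (le_max_right (max k K) N))
    fun j _ _ => by positivity).trans (le_of_eq ?_)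
  refine Finset.sum_congr rfl fun j _ => ?_
  simp [mul_comm]

theorem lintegral_weightedEvidence_rpow_le (hn : n ≠ 0) (p : SievePrior) {a : ℝ} (ha : 0 ≤ a)
    (ha' : 32 * a ≤ 1) {θs t : ℕ → ℝ} {K : ℕ} (ht : ∀ j, K ≤ j → t j = 0)
    (hs : Summable fun j => (θs j - t j) ^ 2) (N k : ℕ) :
    ∫⁻ Y, weightedEvidence n p a θs t K N k Y ^ (1 / 4 : ℝ) ∂(seqLaw n θs) ≤
      ENNReal.ofReal (Real.exp (8 * a * (k + K) + n * ∑' j, (θs j - t j) ^ 2)) := by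
  have hv : (n : ℝ≥0)⁻¹ ≠ 0 := by simpa using hn
  have hv0 : (0 : ℝ) < (n : ℝ≥0)⁻¹ := by positivity
  set m := max (max k K) N
  let ψ : ℕ → ℝ → ℝ≥0∞ := fun j y =>
    ∫⁻ x, ENNReal.ofReal (Real.exp (a * ((x - θs j) ^ 2 / (n : ℝ≥0)⁻¹)) *
        gaussianRatio (n : ℝ≥0)⁻¹ (t j) x y) ∂(p.coordLaw k j)
  have hψ : ∀ j, Measurable (ψ j) := fun j =>
    Measurable.lintegral_prod_left' (f := fun q : ℝ × ℝ =>
      ENNReal.ofReal (Real.exp (a * ((q.1 - θs j) ^ 2 / (n : ℝ≥0)⁻¹)) *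
        gaussianRatio (n : ℝ≥0)⁻¹ (t j) q.1 q.2)) (by fun_prop)
  have hψint : ∀ j, ∫⁻ y, ψ j y ^ (1 / 4 : ℝ) ∂(gaussianReal (θs j) (n : ℝ≥0)⁻¹) ≤
      ENNReal.ofReal (Real.exp ((if j ∈ Finset.range (max k K) then 8 * a else 0) +
        n * (θs j - t j) ^ 2)) := fun j => by
    have hdiv : n * (θs j - t j) ^ 2 = (θs j - t j) ^ 2 / (n : ℝ≥0)⁻¹ := by simp [mul_comm]
    rw [hdiv]
    split_ifs with hj
    · exact lintegral_mixture_rpow_le hv ha ha' (θs j) (t j) (p.coordLaw k j)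
    -- Here the prior is a point mass at `t j = 0`, so the factor is a constant and carries no `8a`.
    -- The total charge is therefore independent of `N`.
    · have hj' : max k K ≤ j := by simpa using hj
      have hlaw : p.coordLaw k j = Measure.dirac 0 := by
        simp [SievePrior.coordLaw, (le_of_max_le_left hj').not_gt]
      have h0 : t j = 0 := ht j (le_of_max_le_right hj')
      simp only [ψ, hlaw, lintegral_dirac, h0, gaussianRatio_self, mul_one]
      rw [lintegral_const, measure_univ, mul_one, ENNReal.ofReal_rpow_of_pos (Real.exp_pos _),
        ← Real.exp_mul]
      refine ENNReal.ofReal_le_ofReal (Real.exp_le_exp.2 ?_)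
      have hd : 0 ≤ (θs j) ^ 2 / ((n : ℝ≥0)⁻¹ : ℝ≥0) := by positivity
      simp only [zero_sub, neg_sq, sub_zero, zero_add]
      nlinarith
  calc _ ≤ ∫⁻ Y, ∏ j ∈ Finset.range m, ψ j (Y j) ^ (1 / 4 : ℝ) ∂(seqLaw n θs) := by
        refine lintegral_mono fun Y => ?_
        simp only
        rw [ENNReal.prod_rpow_of_nonneg (by norm_num)]
        exact ENNReal.rpow_le_rpow (weightedEvidence_le_prod p ha θs ht N k Y) (by norm_num)
    _ = ∏ j ∈ Finset.range m, ∫⁻ y, ψ j y ^ (1 / 4 : ℝ) ∂(gaussianReal (θs j) (n : ℝ≥0)⁻¹) :=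
        lintegral_infinitePi_prod _ _ (fun j y => ψ j y ^ (1 / 4 : ℝ))
          fun j => (hψ j).pow_const _
    _ ≤ ∏ j ∈ Finset.range m, ENNReal.ofReal (Real.exp
          ((if j ∈ Finset.range (max k K) then 8 * a else 0) + n * (θs j - t j) ^ 2)) :=
        Finset.prod_le_prod' fun j _ => hψint j
    _ ≤ _ := by
        rw [← ENNReal.ofReal_prod_of_nonneg fun _ _ => (Real.exp_pos _).le, ← Real.exp_sum,
          Finset.sum_add_distrib, Finset.sum_ite_mem]
        refine ENNReal.ofReal_le_ofReal (Real.exp_le_exp.2 ?_)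
        refine add_le_add ?_ ?_
        swap
        · rw [← Finset.mul_sum]
          exact mul_le_mul_of_nonneg_left (hs.sum_le_tsum _ fun _ _ => sq_nonneg _) (by positivity)
        rw [Finset.sum_const, nsmul_eq_mul, mul_comm]
        refine mul_le_mul_of_nonneg_left ?_ (by positivity)
        have h1 : (Finset.range m ∩ Finset.range (max k K)).card ≤ k + K :=
          (Finset.card_le_card Finset.inter_subset_right).trans (by simp)
        exact_mod_cast h1

theorem measurable_weightedEvidence (p : SievePrior) (a : ℝ) (θs t : ℕ → ℝ) (K N k : ℕ) :
    Measurable (weightedEvidence n p a θs t K N k) := by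
  refine Measurable.lintegral_prod_left' (f := fun q : (ℕ → ℝ) × (ℕ → ℝ) =>
    ENNReal.ofReal (Real.exp (a * (n * ∑ j ∈ Finset.range N, (q.1 j - θs j) ^ 2))) *
    ∏ j ∈ Finset.range (max k K),
      ENNReal.ofReal (gaussianRatio (n : ℝ≥0)⁻¹ (t j) (q.1 j) (q.2 j))) ?_
  refine Measurable.mul (by fun_prop) (Finset.measurable_fun_prod _ fun j _ => ?_)
  fun_prop

/-- The fractional moment of the reweighted evidence of the full sieve prior. -/
theorem lintegral_tsum_weightedEvidence_rpow_le (hn : n ≠ 0) (p : SievePrior) {C₁ C₂ : ℝ}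
    (hC₁ : 0 < C₁) (hC₂ : 0 < C₂)
    (hw : ∀ k : ℕ, 1 ≤ k → p.weight k ≤ C₁ * Real.exp (-C₂ * k)) {a : ℝ} (ha : 0 ≤ a)
    (ha' : 32 * a ≤ 1) (haC : 64 * a ≤ C₂) {θs t : ℕ → ℝ} {K : ℕ} (ht : ∀ j, K ≤ j → t j = 0)
    (hs : Summable fun j => (θs j - t j) ^ 2) (N : ℕ) :
    ∫⁻ Y, (∑' k, ENNReal.ofReal (p.weight k) * weightedEvidence n p a θs t K N k Y) ^ (1 / 4 : ℝ)
        ∂(seqLaw n θs) ≤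
      ENNReal.ofReal (C₁ ^ (1 / 4 : ℝ) * (1 - Real.exp (-C₂ / 8))⁻¹ *
        Real.exp (8 * a * K + n * ∑' j, (θs j - t j) ^ 2)) := by
  set E := Real.exp (8 * a * K + n * ∑' j, (θs j - t j) ^ 2)
  have hE : 0 < E := Real.exp_pos _
  have hq1 : Real.exp (-C₂ / 8) < 1 := by
    rw [Real.exp_lt_one_iff]
    linarith
  have hterm : ∀ k, ∫⁻ Y, (ENNReal.ofReal (p.weight k) *
      weightedEvidence n p a θs t K N k Y) ^ (1 / 4 : ℝ) ∂(seqLaw n θs) ≤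
      ENNReal.ofReal (C₁ ^ (1 / 4 : ℝ) * E * Real.exp (-C₂ / 8) ^ k) := fun k => by
    simp_rw [ENNReal.mul_rpow_of_nonneg _ _ (show (0 : ℝ) ≤ 1 / 4 by norm_num)]
    rw [lintegral_const_mul _ ((measurable_weightedEvidence p a θs t K N k).pow_const _)]
    have hk : ENNReal.ofReal (p.weight k) ^ (1 / 4 : ℝ) ≤
        ENNReal.ofReal (C₁ ^ (1 / 4 : ℝ) * Real.exp (-C₂ * k / 4)) := by
      rcases Nat.eq_zero_or_pos k with rfl | hk
      · simp [p.weight_zero]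
      · rw [ENNReal.ofReal_rpow_of_nonneg (p.weight_nonneg k) (by norm_num)]
        refine ENNReal.ofReal_le_ofReal ?_
        refine (Real.rpow_le_rpow (p.weight_nonneg k) (hw k hk) (by norm_num)).trans (le_of_eq ?_)
        rw [Real.mul_rpow hC₁.le (Real.exp_pos _).le, ← Real.exp_mul]
        congr 2
        ring
    refine (mul_le_mul' hk (lintegral_weightedEvidence_rpow_le hn p ha ha' ht hs N k)).trans ?_
    have hC : 0 ≤ C₁ ^ (1 / 4 : ℝ) := by positivity
    rw [← ENNReal.ofReal_mul (by positivity), mul_assoc (C₁ ^ (1 / 4 : ℝ)),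
      mul_assoc (C₁ ^ (1 / 4 : ℝ))]
    refine ENNReal.ofReal_le_ofReal (mul_le_mul_of_nonneg_left ?_ hC)
    rw [← Real.exp_nat_mul, ← Real.exp_add, ← Real.exp_add]
    refine Real.exp_le_exp.2 ?_
    have hk0 : (0 : ℝ) ≤ k := by positivity
    -- The quarter power of `π(k)` decays at rate `C₂/4`, and `8a ≤ C₂/8` leaves a geometric series
    -- of ratio `exp(-C₂/8)`.
    nlinarith [mul_le_mul_of_nonneg_right haC hk0]
  calc _ ≤ ∫⁻ Y, ∑' k, (ENNReal.ofReal (p.weight k) *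
        weightedEvidence n p a θs t K N k Y) ^ (1 / 4 : ℝ) ∂(seqLaw n θs) :=
        lintegral_mono fun Y => rpow_tsum_le_tsum_rpow _ (by norm_num) (by norm_num)
    _ = ∑' k, ∫⁻ Y, (ENNReal.ofReal (p.weight k) *
        weightedEvidence n p a θs t K N k Y) ^ (1 / 4 : ℝ) ∂(seqLaw n θs) :=
        lintegral_tsum fun k => (((measurable_weightedEvidence p a θs t K N k).const_mul
          _).pow_const _).aemeasurable
    _ ≤ ∑' k, ENNReal.ofReal (C₁ ^ (1 / 4 : ℝ) * E * Real.exp (-C₂ / 8) ^ k) :=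
        ENNReal.tsum_le_tsum hterm
    _ = _ := by
        rw [← ENNReal.ofReal_tsum_of_nonneg (fun k => by positivity)
          ((summable_geometric_of_lt_one (Real.exp_pos _).le hq1).mul_left _), tsum_mul_left,
          tsum_geometric_of_lt_one (Real.exp_pos _).le hq1]
        congr 1
        ring

/-! ### The reference law and its divergence from the posterior -/

/-- The coordinates of the reference mean-field measure: Gaussian fluctuations around `t` in the
first `K` coordinates, a point mass at zero in the others. -/
noncomputable def referenceCoord (n : ℕ) (t : ℕ → ℝ) (K j : ℕ) : Measure ℝ :=
  if j < K then gaussianReal (t j) (n : ℝ≥0)⁻¹ else Measure.dirac 0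

instance (t : ℕ → ℝ) (K j : ℕ) : IsProbabilityMeasure (referenceCoord n t K j) := by
  unfold referenceCoord
  split_ifs <;> infer_instance

/-- The product measure with coordinates `referenceCoord`. -/
noncomputable def referenceLaw (n : ℕ) (t : ℕ → ℝ) (K : ℕ) : Measure (ℕ → ℝ) :=
  Measure.infinitePi (referenceCoord n t K)

instance (t : ℕ → ℝ) (K : ℕ) : IsProbabilityMeasure (referenceLaw n t K) := by
  unfold referenceLaw
  infer_instance

theorem referenceLaw_mem_meanField (t : ℕ → ℝ) (K : ℕ) : referenceLaw n t K ∈ meanField :=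
  ⟨fun j => ⟨referenceCoord n t K j, inferInstance⟩, rfl⟩

theorem referenceLaw_eq_withDensity (hn : n ≠ 0) (p : SievePrior) (t : ℕ → ℝ) {K : ℕ}
    (hpos : ∀ j < K, ∀ x, 0 < p.density j x) :
    referenceLaw n t K = (Measure.infinitePi (p.coordLaw K)).withDensity fun θ =>
      ∏ j ∈ Finset.range K,
        ENNReal.ofReal (gaussianPDFReal (t j) (n : ℝ≥0)⁻¹ (θ j) / p.density j (θ j)) := by
  have hv : (n : ℝ≥0)⁻¹ ≠ 0 := by simpa using hn
  have hmeas : ∀ j, Measurable fun x =>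
      ENNReal.ofReal (gaussianPDFReal (t j) (n : ℝ≥0)⁻¹ x / p.density j x) := fun j =>
    ((measurable_gaussianPDFReal _ _).div (p.density_measurable j)).ennreal_ofReal
  unfold referenceLaw
  refine infinitePi_eq_withDensity_prod (p.coordLaw K) (referenceCoord n t K) (Finset.range K)
    (fun j x => ENNReal.ofReal (gaussianPDFReal (t j) (n : ℝ≥0)⁻¹ x / p.density j x))
    hmeas (fun j hj => ?_) fun j hj => ?_
  · have hj' : j < K := Finset.mem_range.1 hj
    simp only [referenceCoord, SievePrior.coordLaw, hj', if_true]
    rw [gaussianReal_of_var_ne_zero _ hv,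
      ← withDensity_mul _ (p.density_measurable j).ennreal_ofReal (hmeas j)]
    congr 1
    ext x
    simp only [Pi.mul_apply, gaussianPDF]
    rw [← ENNReal.ofReal_mul (p.density_nonneg j x), mul_div_cancel₀ _ (hpos j hj' x).ne']
  · have hj' : ¬ j < K := by simpa using hj
    simp [referenceCoord, SievePrior.coordLaw, hj']

/-- A bound for the log-density of the reference law relative to the posterior, one coordinate. -/
noncomputable def coordBound (n : ℕ) (c d t y x : ℝ) : ℝ :=
  Real.log n / 2 + c + d * x ^ 2 - n * ((x - t) * (y - t))

/-- The quadratic `-n (x - t)²/2` occurs in both the Gaussian log-density and the log-likelihood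
ratio and cancels. Only a term linear in `x - t` still involves the observation. -/
theorem gaussianPDFReal_div_le (hn : n ≠ 0) {f c d t x : ℝ} (hf : 0 < f)
    (hlog : -Real.log f ≤ c + d * x ^ 2) (y : ℝ) :
    gaussianPDFReal t (n : ℝ≥0)⁻¹ x / f ≤
      gaussianRatio (n : ℝ≥0)⁻¹ t x y * Real.exp (coordBound n c d t y x) := by
  have hn1 : (1 : ℝ) ≤ n := by exact_mod_cast Nat.one_le_iff_ne_zero.2 hn
  have hn0 : (0 : ℝ) < n := by linarith
  have h1 : f⁻¹ ≤ Real.exp (c + d * x ^ 2) := by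
    rw [← Real.exp_log hf, ← Real.exp_neg]
    exact Real.exp_le_exp.2 hlog
  have h2 : (√(2 * Real.pi * ((n : ℝ≥0)⁻¹ : ℝ≥0)))⁻¹ ≤ Real.exp (Real.log n / 2) := by
    have h3 : Real.exp (Real.log n / 2) = √n := by
      rw [Real.sqrt_eq_rpow, Real.rpow_def_of_pos hn0]
      congr 1
      ring
    rw [h3, ← Real.sqrt_inv]
    refine Real.sqrt_le_sqrt ?_
    rw [NNReal.coe_inv, NNReal.coe_natCast, mul_inv, inv_inv]
    refine mul_le_of_le_one_left hn0.le (inv_le_one_of_one_le₀ ?_)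
    linarith [Real.pi_gt_three]
  calc gaussianPDFReal t (n : ℝ≥0)⁻¹ x / f
      = (√(2 * Real.pi * ((n : ℝ≥0)⁻¹ : ℝ≥0)))⁻¹ *
          Real.exp (-(x - t) ^ 2 / (2 * ((n : ℝ≥0)⁻¹ : ℝ≥0))) * f⁻¹ := rfl
    _ ≤ Real.exp (Real.log n / 2) * Real.exp (-(x - t) ^ 2 / (2 * ((n : ℝ≥0)⁻¹ : ℝ≥0))) *
          Real.exp (c + d * x ^ 2) := by gcongr
    _ = _ := by
        rw [gaussianRatio, coordBound, ← Real.exp_add, ← Real.exp_add, ← Real.exp_add]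
        congr 1
        rw [NNReal.coe_inv, NNReal.coe_natCast]
        field_simp
        ring

theorem integral_sq_gaussianReal (t : ℝ) (v : ℝ≥0) :
    ∫ x, x ^ 2 ∂(gaussianReal t v) = t ^ 2 + v := by
  have h := variance_eq_sub (memLp_id_gaussianReal (μ := t) (v := v) 2)
  simp only [variance_id_gaussianReal, Pi.pow_apply, id_eq, integral_id_gaussianReal] at h
  linarith

theorem integrable_coordBound (c d t y : ℝ) (v : ℝ≥0) :
    Integrable (coordBound n c d t y) (gaussianReal t v) := by
  have h1 : Integrable (fun x : ℝ => x) (gaussianReal t v) :=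
    (memLp_id_gaussianReal (μ := t) (v := v) 1).integrable le_rfl
  have h2 : Integrable (fun x : ℝ => x ^ 2) (gaussianReal t v) :=
    (memLp_id_gaussianReal (μ := t) (v := v) 2).integrable_sq
  exact ((integrable_const _).add (h2.const_mul d)).sub
    (((h1.sub (integrable_const t)).mul_const (y - t)).const_mul (n : ℝ))

/-- The term involving `y` is centred under `N(t, v)`, so the complexity bound does not depend on
the data. -/
theorem integral_coordBound (c d t y : ℝ) (v : ℝ≥0) :
    ∫ x, coordBound n c d t y x ∂(gaussianReal t v) = Real.log n / 2 + c + d * (t ^ 2 + v) := by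
  have h1 : Integrable (fun x : ℝ => x) (gaussianReal t v) :=
    (memLp_id_gaussianReal (μ := t) (v := v) 1).integrable le_rfl
  have h2 : Integrable (fun x : ℝ => x ^ 2) (gaussianReal t v) :=
    (memLp_id_gaussianReal (μ := t) (v := v) 2).integrable_sq
  simp only [coordBound]
  rw [integral_sub, integral_add, integral_const_mul, integral_const_mul, integral_mul_const,
    integral_sub h1 (integrable_const t), integral_id_gaussianReal, integral_sq_gaussianReal]
  · simp
  · exact integrable_const _
  · exact h2.const_mul d
  · exact (integrable_const _).add (h2.const_mul d)
  · exact ((h1.sub (integrable_const t)).mul_const (y - t)).const_mul (n : ℝ)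

/-- The reference law has a small divergence from any posterior of the form given by
`posterior_eq_sum`. -/
theorem klDiv_referenceLaw_le (hn : n ≠ 0) (p : SievePrior) {t : ℕ → ℝ} {K : ℕ} {c : ℝ} {d : ℕ → ℝ}
    (hK : 0 < p.weight K)
    (hdens : ∀ j < K, ∀ x, 0 < p.density j x ∧ -Real.log (p.density j x) ≤ c + d j * x ^ 2)
    {Y : ℕ → ℝ} {w : ℝ} (hw : 0 < w) {μ : Measure (ℕ → ℝ)} [IsProbabilityMeasure μ]
    (hμ : μ = Measure.sum fun k => ENNReal.ofReal (p.weight k) •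
        (Measure.infinitePi (p.coordLaw k)).withDensity fun θ => ENNReal.ofReal w *
            ∏ j ∈ Finset.range (max k K),
              ENNReal.ofReal (gaussianRatio (n : ℝ≥0)⁻¹ (t j) (θ j) (Y j))) :
    0 ≤ -Real.log (p.weight K) +
        ∑ j ∈ Finset.range K, (Real.log n / 2 + c + d j * (t j ^ 2 + (n : ℝ)⁻¹)) - Real.log w ∧
      klDiv (referenceLaw n t K) μ ≤ ENNReal.ofReal (-Real.log (p.weight K) +
        ∑ j ∈ Finset.range K, (Real.log n / 2 + c + d j * (t j ^ 2 + (n : ℝ)⁻¹)) - Real.log w) := by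
  let U : (ℕ → ℝ) → ℝ := fun θ => (-Real.log (p.weight K) - Real.log w) +
    ∑ j ∈ Finset.range K, coordBound n c (d j) (t j) (Y j) (θ j)
  have hmp : ∀ j ∈ Finset.range K, MeasurePreserving (fun θ : ℕ → ℝ => θ j) (referenceLaw n t K)
      (gaussianReal (t j) (n : ℝ≥0)⁻¹) := fun j hj => by
    have := measurePreserving_eval_infinitePi (referenceCoord n t K) j
    have h2 : referenceCoord n t K j = gaussianReal (t j) (n : ℝ≥0)⁻¹ := by
      simp [referenceCoord, Finset.mem_range.1 hj]
    rwa [h2] at this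
  have hint : ∀ j ∈ Finset.range K, Integrable
      (fun θ : ℕ → ℝ => coordBound n c (d j) (t j) (Y j) (θ j)) (referenceLaw n t K) :=
    fun j hj => (hmp j hj).integrable_comp_of_integrable (integrable_coordBound _ _ _ _ _)
  have hUint : Integrable U (referenceLaw n t K) :=
    (integrable_const _).add (integrable_finsetSum _ hint)
  have hUval : ∫ θ, U θ ∂(referenceLaw n t K) = -Real.log (p.weight K) +
      ∑ j ∈ Finset.range K, (Real.log n / 2 + c + d j * (t j ^ 2 + (n : ℝ)⁻¹)) - Real.log w := by
    simp only [U]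
    rw [integral_add (integrable_const _) (integrable_finsetSum _ hint),
      integral_finsetSum _ hint, integral_const, probReal_univ, one_smul]
    have : ∀ j ∈ Finset.range K, ∫ θ, coordBound n c (d j) (t j) (Y j) (θ j)
        ∂(referenceLaw n t K) = Real.log n / 2 + c + d j * (t j ^ 2 + (n : ℝ)⁻¹) := fun j hj => by
      have hmap := integral_map (μ := referenceLaw n t K) (φ := fun θ : ℕ → ℝ => θ j)
        (f := coordBound n c (d j) (t j) (Y j)) (hmp j hj).measurable.aemeasurable
        (by rw [(hmp j hj).map_eq]; exact (integrable_coordBound _ _ _ _ _).aestronglyMeasurable)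
      rw [← hmap, (hmp j hj).map_eq, integral_coordBound]
      simp
    rw [Finset.sum_congr rfl this]
    ring
  have hUm : Measurable U := by
    simp only [U, coordBound]
    fun_prop
  rw [← hUval]
  refine klDiv_le_of_le_withDensity_exp hUint ?_
  let G : (ℕ → ℝ) → ℝ≥0∞ := fun θ => ENNReal.ofReal w * ∏ j ∈ Finset.range K,
    ENNReal.ofReal (gaussianRatio (n : ℝ≥0)⁻¹ (t j) (θ j) (Y j))
  have hG : Measurable G := by
    refine Measurable.const_mul (Finset.measurable_fun_prod _ fun j _ => ?_) _
    fun_prop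
  -- The posterior dominates its component of dimension `K`. Discarding the others costs only `-log
  -- π(K)`.
  have hcomp : ENNReal.ofReal (p.weight K) • (Measure.infinitePi (p.coordLaw K)).withDensity G ≤
      μ := by
    rw [hμ]
    refine le_trans (le_of_eq ?_) (Measure.le_sum _ K)
    simp only [max_self, G]
  calc referenceLaw n t K
      ≤ (Measure.infinitePi (p.coordLaw K)).withDensity
          (ENNReal.ofReal (p.weight K) • (G * fun θ => ENNReal.ofReal (Real.exp (U θ)))) := by
        rw [referenceLaw_eq_withDensity hn p t fun j hj x => (hdens j hj x).1]
        refine withDensity_mono (ae_of_all _ fun θ => ?_)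
        simp only [Pi.smul_apply, Pi.mul_apply, smul_eq_mul, G]
        rw [← ENNReal.ofReal_prod_of_nonneg fun j _ => (gaussianRatio_pos _ _ _ _).le,
          ← ENNReal.ofReal_mul hw.le,
          ← ENNReal.ofReal_mul (mul_nonneg hw.le
            (Finset.prod_nonneg fun j _ => (gaussianRatio_pos _ _ _ _).le)),
          ← ENNReal.ofReal_mul hK.le, ← ENNReal.ofReal_prod_of_nonneg fun j hj =>
            div_nonneg (gaussianPDFReal_nonneg _ _ _) (p.density_nonneg j _)]
        refine ENNReal.ofReal_le_ofReal ?_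
        have hU : Real.exp (U θ) = (p.weight K)⁻¹ * w⁻¹ *
            ∏ j ∈ Finset.range K, Real.exp (coordBound n c (d j) (t j) (Y j) (θ j)) := by
          simp only [U]
          rw [Real.exp_add, Real.exp_sum, Real.exp_sub, Real.exp_neg, Real.exp_log hK,
            Real.exp_log hw, div_eq_mul_inv]
        rw [hU]
        have hre : ∀ a b : ℝ, p.weight K * (w * a * ((p.weight K)⁻¹ * w⁻¹ * b)) = a * b :=
          fun a b => by field_simp
        rw [hre, ← Finset.prod_mul_distrib]
        refine Finset.prod_le_prod (fun j hj =>
          div_nonneg (gaussianPDFReal_nonneg _ _ _) (p.density_nonneg j _)) fun j hj => ?_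
        have hd := hdens j (Finset.mem_range.1 hj) (θ j)
        exact gaussianPDFReal_div_le hn hd.1 hd.2 (Y j)
    _ = (ENNReal.ofReal (p.weight K) • (Measure.infinitePi (p.coordLaw K)).withDensity G
          ).withDensity fun θ => ENNReal.ofReal (Real.exp (U θ)) := by
        rw [withDensity_smul_measure, withDensity_smul _ (hG.mul hUm.exp.ennreal_ofReal),
          withDensity_mul _ hG hUm.exp.ennreal_ofReal]
    _ ≤ _ := by
        refine Measure.le_iff.2 fun s hs => ?_
        rw [withDensity_apply _ hs, withDensity_apply _ hs]
        exact lintegral_mono' (Measure.restrict_mono le_rfl hcomp) le_rfl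

/-- Tangent line of the logarithm at `c`, applied to `x^{1/4}`. It plays the role of Jensen's
inequality when `c` bounds the mean of `x^{1/4}`. -/
theorem log_le_rpow_div {x c : ℝ} (hx : 0 < x) (hc : 0 < c) :
    Real.log x ≤ 4 * Real.log c + 4 / c * x ^ (1 / 4 : ℝ) := by
  have hx4 : 0 < x ^ (1 / 4 : ℝ) := Real.rpow_pos_of_pos hx _
  have h := Real.log_le_sub_one_of_pos (div_pos hx4 hc)
  rw [Real.log_div hx4.ne' hc.ne', Real.log_rpow hx] at h
  have : 4 / c * x ^ (1 / 4 : ℝ) = 4 * (x ^ (1 / 4 : ℝ) / c) := by ring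
  linarith

/-! ### Risk bound for the variational posterior -/

/-- The risk of a variational posterior is controlled by the divergence of the reference law from
the prior and by a fractional moment of the reweighted evidence. -/
theorem lintegral_variationalPosterior_le (hn : n ≠ 0) (p : SievePrior)
    {Qhat : Kernel (ℕ → ℝ) (ℕ → ℝ)} (hQ : IsVariationalPosterior n p Qhat) {θs t : ℕ → ℝ}
    (hθs : Summable fun j => θs j ^ 2) {K : ℕ} (ht : ∀ j, K ≤ j → t j = 0) {c₀ : ℝ} {d : ℕ → ℝ}
    (hK : 0 < p.weight K)
    (hdens : ∀ j < K, ∀ x, 0 < p.density j x ∧ -Real.log (p.density j x) ≤ c₀ + d j * x ^ 2)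
    {a : ℝ} (ha : 0 ≤ a) (N : ℕ) {c D : ℝ} (hc : 1 ≤ c) (hD0 : 0 ≤ D)
    (hcX : ∫⁻ Y, (∑' k, ENNReal.ofReal (p.weight k) * weightedEvidence n p a θs t K N k Y)
      ^ (1 / 4 : ℝ) ∂(seqLaw n θs) ≤ ENNReal.ofReal c)
    (hD : -Real.log (p.weight K) +
      ∑ j ∈ Finset.range K, (Real.log n / 2 + c₀ + d j * (t j ^ 2 + (n : ℝ)⁻¹)) ≤ D) :
    ∫⁻ Y, ∫⁻ θ, ENNReal.ofReal (a * (n * ∑ j ∈ Finset.range N, (θ j - θs j) ^ 2)) ∂(Qhat Y)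
      ∂(seqLaw n θs) ≤ ENNReal.ofReal (D + 4 * Real.log c + 4) := by
  set marg := (model n) ∘ₘ p.toMeasure
  set X : (ℕ → ℝ) → ℝ≥0∞ := fun Y =>
    ∑' k, ENNReal.ofReal (p.weight k) * weightedEvidence n p a θs t K N k Y
  have hXm : Measurable X := Measurable.tsum fun k =>
    (measurable_weightedEvidence p a θs t K N k).const_mul _
  have hc0 : 0 < c := by linarith
  have hlogc : 0 ≤ Real.log c := Real.log_nonneg hc
  have hst : seqLaw n θs ≪ seqLaw n t := seqLaw_absolutelyContinuous hn
    (summable_sq_sub hθs (summable_sq_of_finite_support ht))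
  have htm : seqLaw n t ≪ marg :=
    seqLaw_absolutelyContinuous_marginal hn p (summable_sq_of_finite_support ht)
  have hsm : seqLaw n θs ≪ marg := hst.trans htm
  have hXfin : ∀ᵐ Y ∂(seqLaw n θs), X Y ^ (1 / 4 : ℝ) < ∞ :=
    ae_lt_top (hXm.pow_const _) (hcX.trans_lt ENNReal.ofReal_lt_top).ne
  have hpt : ∀ᵐ Y ∂(seqLaw n θs),
      ∫⁻ θ, ENNReal.ofReal (a * (n * ∑ j ∈ Finset.range N, (θ j - θs j) ^ 2)) ∂(Qhat Y) ≤
        ENNReal.ofReal (D + 4 * Real.log c) + ENNReal.ofReal (4 / c) * X Y ^ (1 / 4 : ℝ) := by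
    filter_upwards [hsm hQ, hsm (posterior_eq_sum hn p ht), hst (Measure.rnDeriv_pos htm),
      hsm (Measure.rnDeriv_lt_top (seqLaw n t) marg), hXfin] with Y hQY hpost hwpos hwtop hXY
    obtain ⟨⟨q, hq⟩, hmin⟩ := hQY
    have hprob : IsProbabilityMeasure (Qhat Y) := by
      rw [hq]
      infer_instance
    set w := ((seqLaw n t).rnDeriv marg Y).toReal
    have hw : 0 < w := ENNReal.toReal_pos hwpos.ne' hwtop.ne
    rw [← ENNReal.ofReal_toReal hwtop.ne] at hpost
    set x := (X Y).toReal
    have hXtop : X Y ≠ ∞ := by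
      intro h
      rw [h, ENNReal.top_rpow_of_pos (by norm_num)] at hXY
      exact lt_irrefl _ hXY
    have hXx : X Y = ENNReal.ofReal x := (ENNReal.ofReal_toReal hXtop).symm
    have hx0 : 0 ≤ x := ENNReal.toReal_nonneg
    let f : (ℕ → ℝ) → ℝ := fun θ => a * (n * ∑ j ∈ Finset.range N, (θ j - θs j) ^ 2)
    have hf : Measurable f := by
      simp only [f]
      fun_prop
    have hf0 : ∀ θ, 0 ≤ f θ := fun θ => by
      have := Finset.sum_nonneg fun j (_ : j ∈ Finset.range N) => sq_nonneg (θ j - θs j)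
      positivity
    have hexp : ∫⁻ θ, ENNReal.ofReal (Real.exp (f θ)) ∂(posterior (model n) p.toMeasure Y) =
        ENNReal.ofReal (w * x) := by
      rw [hpost, lintegral_sum_measure, ENNReal.ofReal_mul hw.le, ← hXx, ← ENNReal.tsum_mul_left]
      refine tsum_congr fun k => ?_
      have hprodm : Measurable fun θ : ℕ → ℝ => ∏ j ∈ Finset.range (max k K),
          ENNReal.ofReal (gaussianRatio (n : ℝ≥0)⁻¹ (t j) (θ j) (Y j)) :=
        Finset.measurable_fun_prod _ fun j _ => by fun_prop
      have hm : Measurable fun θ : ℕ → ℝ =>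
          ENNReal.ofReal (Real.exp (a * (n * ∑ j ∈ Finset.range N, (θ j - θs j) ^ 2))) *
            ∏ j ∈ Finset.range (max k K),
              ENNReal.ofReal (gaussianRatio (n : ℝ≥0)⁻¹ (t j) (θ j) (Y j)) :=
        hf.exp.ennreal_ofReal.mul hprodm
      rw [lintegral_smul_measure, lintegral_withDensity_eq_lintegral_mul _
        (hprodm.const_mul _) hf.exp.ennreal_ofReal, weightedEvidence, smul_eq_mul, mul_left_comm,
        ← lintegral_const_mul _ hm]
      congr 1
      refine lintegral_congr fun θ => ?_
      simp only [Pi.mul_apply, f]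
      ring
    -- The exponential moment of a nonnegative function under a probability measure is at least one.
    -- This gives the nonnegative logarithm needed below and `x > 0`.
    have hF : 1 ≤ w * x := by
      have h1 : (1 : ℝ≥0∞) ≤ ENNReal.ofReal (w * x) := by
        rw [← hexp, ← measure_univ (μ := posterior (model n) p.toMeasure Y), ← lintegral_one]
        refine lintegral_mono fun θ => ?_
        simpa using ENNReal.ofReal_le_ofReal (Real.one_le_exp (hf0 θ))
      simpa using (ENNReal.ofReal_le_ofReal_iff (by positivity)).1 (ENNReal.ofReal_one ▸ h1)
    have hxpos : 0 < x := by
      rcases hx0.eq_or_lt with h | h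
      · rw [← h, mul_zero] at hF
        linarith
      · exact h
    obtain ⟨hkl0, hkl⟩ := klDiv_referenceLaw_le hn p hK hdens hw hpost
    have hlogF : Real.log (w * x) = Real.log w + Real.log x := Real.log_mul hw.ne' hxpos.ne'
    calc _ ≤ klDiv (Qhat Y) (posterior (model n) p.toMeasure Y) +
          ENNReal.ofReal (Real.log (w * x)) := lintegral_le_klDiv_add_log hf hf0 hF hexp.le
      _ ≤ _ := add_le_add_left ((hmin _ (referenceLaw_mem_meanField t K)).trans hkl) _
      _ ≤ ENNReal.ofReal ((D + 4 * Real.log c) + 4 / c * x ^ (1 / 4 : ℝ)) := by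
          -- The sum is taken inside `ofReal`, so that `-log w` from the divergence cancels `log w`
          -- from the exponential moment.
          rw [← ENNReal.ofReal_add hkl0 (Real.log_nonneg hF), hlogF]
          refine ENNReal.ofReal_le_ofReal ?_
          linarith [log_le_rpow_div hxpos hc0]
      _ = _ := by
          rw [ENNReal.ofReal_add (by positivity) (by positivity), ENNReal.ofReal_mul (by positivity),
            hXx, ENNReal.ofReal_rpow_of_pos hxpos]
  calc _ ≤ ∫⁻ Y, (ENNReal.ofReal (D + 4 * Real.log c) + ENNReal.ofReal (4 / c) *
        X Y ^ (1 / 4 : ℝ)) ∂(seqLaw n θs) := lintegral_mono_ae hpt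
    _ = ENNReal.ofReal (D + 4 * Real.log c) + ENNReal.ofReal (4 / c) *
        ∫⁻ Y, X Y ^ (1 / 4 : ℝ) ∂(seqLaw n θs) := by
      rw [lintegral_add_left measurable_const, lintegral_const, measure_univ, mul_one,
        lintegral_const_mul _ (hXm.pow_const _)]
    _ ≤ ENNReal.ofReal (D + 4 * Real.log c) + ENNReal.ofReal (4 / c) * ENNReal.ofReal c := by
      gcongr
    _ = _ := by
      rw [← ENNReal.ofReal_mul (by positivity), div_mul_cancel₀ _ hc0.ne',
        ← ENNReal.ofReal_add (by positivity) (by norm_num)]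

/-- A uniform bound on the risks of all finite collections of coordinates bounds the full risk. -/
theorem lintegral_sqDist_le (Qhat : Kernel (ℕ → ℝ) (ℕ → ℝ)) (θs : ℕ → ℝ) (P : Measure (ℕ → ℝ))
    {b R : ℝ} (hb : 0 < b)
    (h : ∀ N, ∫⁻ Y, ∫⁻ θ, ENNReal.ofReal (b * ∑ j ∈ Finset.range N, (θ j - θs j) ^ 2) ∂(Qhat Y) ∂P ≤
      ENNReal.ofReal R) :
    ∫⁻ Y, ∫⁻ θ, sqDist θ θs ∂(Qhat Y) ∂P ≤ ENNReal.ofReal (R / b) := by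
  have hm : ∀ j, Measurable fun θ : ℕ → ℝ => ENNReal.ofReal ((θ j - θs j) ^ 2) := fun j => by
    fun_prop
  have hmk : ∀ j, Measurable fun Y => ∫⁻ θ, ENNReal.ofReal ((θ j - θs j) ^ 2) ∂(Qhat Y) :=
    fun j => (hm j).lintegral_kernel
  simp only [sqDist]
  simp_rw [lintegral_tsum fun j => (hm j).aemeasurable]
  rw [lintegral_tsum fun j => (hmk j).aemeasurable]
  refine ENNReal.tsum_le_of_sum_range_le fun N => ?_
  rw [ENNReal.ofReal_div_of_pos hb, ENNReal.le_div_iff_mul_le (Or.inl (by simpa using hb))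
    (Or.inl ENNReal.ofReal_ne_top), mul_comm]
  refine le_trans (le_of_eq ?_) (h N)
  rw [← lintegral_finsetSum _ fun j _ => hmk j,
    ← lintegral_const_mul _ (Finset.measurable_fun_sum _ fun j _ => hmk j)]
  refine lintegral_congr fun Y => ?_
  rw [← lintegral_finsetSum _ fun j _ => hm j,
    ← lintegral_const_mul _ (Finset.measurable_fun_sum _ fun j _ => hm j)]
  refine lintegral_congr fun θ => ?_
  rw [ENNReal.ofReal_mul hb.le, ENNReal.ofReal_sum_of_nonneg fun j _ => sq_nonneg _]

/-! ### Dimension and rate computations -/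

theorem half_le_log {n : ℕ} (hn : 2 ≤ n) : 1 / 2 ≤ Real.log n := by
  have h2 : (2 : ℝ) ≤ n := by exact_mod_cast hn
  have := Real.log_le_log (by norm_num) h2
  linarith [Real.log_two_gt_d9]

/-- The real number whose ceiling is `effDim`. -/
noncomputable def realDim (α : ℝ) (n : ℕ) : ℝ := ((n : ℝ) / Real.log n) ^ (1 / (2 * α + 1))

section Rates

variable {α : ℝ}

theorem one_le_div_log (hn : 2 ≤ n) : 1 ≤ (n : ℝ) / Real.log n := by
  have hL := half_le_log hn
  have hn0 : (0 : ℝ) < n := by positivity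
  rw [le_div_iff₀ (by linarith)]
  linarith [Real.log_le_sub_one_of_pos hn0]

theorem one_le_realDim (hα : 0 < α) (hn : 2 ≤ n) : 1 ≤ realDim α n :=
  Real.one_le_rpow (one_le_div_log hn) (by positivity)

theorem realDim_le_effDim (α : ℝ) (n : ℕ) : realDim α n ≤ effDim α n := Nat.le_ceil _

theorem effDim_le_two_mul_realDim (hα : 0 < α) (hn : 2 ≤ n) :
    (effDim α n : ℝ) ≤ 2 * realDim α n := by
  have h1 := one_le_realDim hα hn
  have h2 := (Nat.ceil_lt_add_one (show 0 ≤ realDim α n by linarith)).le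
  change (effDim α n : ℝ) ≤ _ at h2
  linarith

theorem one_le_effDim (hα : 0 < α) (hn : 2 ≤ n) : 1 ≤ effDim α n := by
  exact_mod_cast (one_le_realDim hα hn).trans (realDim_le_effDim α n)

theorem realDim_rpow (hα : 0 < α) (hn : 2 ≤ n) :
    realDim α n ^ (2 * α + 1) = (n : ℝ) / Real.log n := by
  have h := one_le_div_log hn
  rw [realDim, ← Real.rpow_mul (by linarith), one_div_mul_cancel (by linarith), Real.rpow_one]

/-- Crudely, `k_0 ≤ 2n / log n ≤ 4n ≤ n³`. -/
theorem log_effDim_le (hα : 0 < α) (hn : 2 ≤ n) :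
    Real.log (effDim α n) ≤ 3 * Real.log n := by
  have h2 : (2 : ℝ) ≤ n := by exact_mod_cast hn
  have hL := half_le_log hn
  have hr := one_le_div_log hn
  have hx : realDim α n ≤ (n : ℝ) / Real.log n := by
    refine (Real.rpow_le_rpow_of_exponent_le hr ?_).trans (le_of_eq (Real.rpow_one _))
    rw [div_le_one (by linarith)]
    linarith
  have hr2 : (n : ℝ) / Real.log n ≤ 2 * n := by
    rw [div_le_iff₀ (by linarith)]
    nlinarith
  have hK : (effDim α n : ℝ) ≤ (n : ℝ) ^ 3 := by
    have := effDim_le_two_mul_realDim hα hn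
    have h4 : 4 * (n : ℝ) ≤ (n : ℝ) ^ 3 := by
      rw [pow_succ]
      exact mul_le_mul_of_nonneg_right (by nlinarith) (by positivity)
    linarith
  have hK1 : (0 : ℝ) < effDim α n := by exact_mod_cast one_le_effDim hα hn
  have := Real.log_le_log hK1 hK
  rwa [Real.log_pow] at this

/-- The balance defining the dimension: squared bias times `n` equals dimension times `log n`. -/
theorem mul_realDim_rpow_neg (hα : 0 < α) (hn : 2 ≤ n) :
    n * realDim α n ^ (-(2 * α)) = realDim α n * Real.log n := by
  have hx : 0 < realDim α n := by linarith [one_le_realDim hα hn]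
  have hL : 0 < Real.log n := by linarith [half_le_log hn]
  have h := realDim_rpow hα hn
  rw [Real.rpow_add hx, Real.rpow_one, eq_div_iff hL.ne'] at h
  have hp : 0 < realDim α n ^ (2 * α) := Real.rpow_pos_of_pos hx _
  rw [Real.rpow_neg hx.le, ← div_eq_mul_inv, div_eq_iff hp.ne']
  linarith

theorem rate_eq (hα : 0 < α) (hn : 2 ≤ n) :
    (n : ℝ) ^ (-(2 * α / (2 * α + 1))) * Real.log n ^ (2 * α / (2 * α + 1)) =
      realDim α n * Real.log n / n := by
  have hn0 : (0 : ℝ) < n := by positivity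
  have hL : 0 < Real.log n := by linarith [half_le_log hn]
  rw [← mul_realDim_rpow_neg hα hn, mul_div_cancel_left₀ _ hn0.ne', realDim,
    ← Real.rpow_mul (by positivity), Real.div_rpow hn0.le hL.le,
    show 1 / (2 * α + 1) * -(2 * α) = -(2 * α / (2 * α + 1)) by ring, Real.rpow_neg hL.le,
    div_inv_eq_mul]

/-- The truncation of a sequence to its first `K` entries. -/
def truncate (θ : ℕ → ℝ) (K j : ℕ) : ℝ := if j < K then θ j else 0

theorem truncate_eq_zero (θ : ℕ → ℝ) {K j : ℕ} (h : K ≤ j) : truncate θ K j = 0 := by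
  simp [truncate, h.not_gt]

theorem summable_sq_of_mem_sobolevBall {B : ℝ} (hα : 0 < α) {θ : ℕ → ℝ}
    (hθ : θ ∈ sobolevBall α B) : Summable fun j => θ j ^ 2 := by
  refine Summable.of_nonneg_of_le (fun _ => sq_nonneg _) (fun j => ?_) hθ.1
  refine le_mul_of_one_le_left (sq_nonneg _) (Real.one_le_rpow ?_ (by linarith))
  linarith [Nat.cast_nonneg (α := ℝ) j]

theorem mul_tsum_sub_truncate_le {B : ℝ} (hα : 0 < α) (hn : 2 ≤ n) {θ : ℕ → ℝ}
    (hθ : θ ∈ sobolevBall α B) :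
    (Summable fun j => (θ j - truncate θ (effDim α n) j) ^ 2) ∧
      n * ∑' j, (θ j - truncate θ (effDim α n) j) ^ 2 ≤ B ^ 2 * (realDim α n * Real.log n) := by
  have hx : 0 < realDim α n := by linarith [one_le_realDim hα hn]
  have hle : ∀ j : ℕ, (θ j - truncate θ (effDim α n) j) ^ 2 ≤
      realDim α n ^ (-(2 * α)) * (((j : ℝ) + 1) ^ (2 * α) * θ j ^ 2) := fun j => by
    by_cases hj : j < effDim α n
    · rw [truncate, if_pos hj, sub_self, zero_pow two_ne_zero]
      positivity
    · simp only [truncate, hj, if_false, sub_zero]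
      rw [← mul_assoc, Real.rpow_neg hx.le, ← div_eq_inv_mul]
      refine le_mul_of_one_le_left (sq_nonneg _) ?_
      rw [one_le_div (by positivity)]
      refine Real.rpow_le_rpow hx.le ?_ (by linarith)
      have : (effDim α n : ℝ) ≤ j := by exact_mod_cast not_lt.1 hj
      linarith [realDim_le_effDim α n]
  have hs := Summable.of_nonneg_of_le (fun _ => sq_nonneg _) hle (hθ.1.mul_left _)
  refine ⟨hs, ?_⟩
  rw [← mul_realDim_rpow_neg hα hn]
  have h1 := hs.tsum_le_tsum hle (hθ.1.mul_left _)
  rw [tsum_mul_left] at h1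
  calc _ ≤ n * (realDim α n ^ (-(2 * α)) * B ^ 2) := by
        refine mul_le_mul_of_nonneg_left (h1.trans ?_) (by positivity)
        exact mul_le_mul_of_nonneg_left hθ.2 (by positivity)
    _ = _ := by ring

theorem sum_range_mul_truncate_sq_le {B : ℝ} {θ : ℕ → ℝ}
    (hθ : θ ∈ sobolevBall α B) (K : ℕ) :
    ∑ j ∈ Finset.range K, ((j : ℝ) + 1) ^ (2 * α + 1) * truncate θ K j ^ 2 ≤ K * B ^ 2 := by
  calc _ ≤ ∑ j ∈ Finset.range K, K * (((j : ℝ) + 1) ^ (2 * α) * θ j ^ 2) := by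
        refine Finset.sum_le_sum fun j hj => ?_
        have hj' : j < K := Finset.mem_range.1 hj
        have hjK : (j : ℝ) + 1 ≤ K := by exact_mod_cast hj'
        rw [Real.rpow_add (by positivity), Real.rpow_one, truncate, if_pos hj',
          mul_comm _ ((j : ℝ) + 1), mul_assoc]
        exact mul_le_mul_of_nonneg_right hjK (by positivity)
    _ ≤ K * B ^ 2 := by
        rw [← Finset.mul_sum]
        refine mul_le_mul_of_nonneg_left ?_ (by positivity)
        exact (hθ.1.sum_le_tsum _ fun j _ => by positivity).trans hθ.2

/-- Each summand is at most `(2x)^{2α+1}/n = 2^{2α+1}/log n`; then `1/log n ≤ 4 log n` because `log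
n ≥ 1/2`. -/
theorem sum_range_rpow_div_le (hα : 0 < α) (hn : 2 ≤ n) :
    ∑ j ∈ Finset.range (effDim α n), ((j : ℝ) + 1) ^ (2 * α + 1) * (n : ℝ)⁻¹ ≤
      8 * 2 ^ (2 * α + 1) * (realDim α n * Real.log n) := by
  have hx : 0 < realDim α n := by linarith [one_le_realDim hα hn]
  have hL := half_le_log hn
  have hn0 : (0 : ℝ) < n := by positivity
  have hK := effDim_le_two_mul_realDim hα hn
  calc _ ≤ ∑ j ∈ Finset.range (effDim α n), (2 * realDim α n) ^ (2 * α + 1) * (n : ℝ)⁻¹ := by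
        refine Finset.sum_le_sum fun j hj => ?_
        have hj' : (j : ℝ) + 1 ≤ effDim α n := by exact_mod_cast Finset.mem_range.1 hj
        gcongr
        linarith
    _ = effDim α n * (2 ^ (2 * α + 1) * (Real.log n)⁻¹) := by
        rw [Finset.sum_const, Finset.card_range, nsmul_eq_mul, Real.mul_rpow (by norm_num) hx.le,
          realDim_rpow hα hn]
        field_simp
    _ ≤ 2 * realDim α n * (2 ^ (2 * α + 1) * (4 * Real.log n)) := by
        have h2 : (Real.log n)⁻¹ ≤ 4 * Real.log n := by
          rw [inv_le_iff_one_le_mul₀ (by linarith)]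
          nlinarith
        gcongr
    _ = _ := by ring

theorem PriorCondition.weight_le {C₁ C₂ C₃ C₄ c₀ c₁ : ℝ} {p : SievePrior}
    (hp : PriorCondition α C₁ C₂ C₃ C₄ c₀ c₁ n p) (k : ℕ) (hk : 1 ≤ k) :
    p.weight k ≤ C₁ * Real.exp (-C₂ * k) := by
  have hs : Summable fun i => p.weight (k + i) := by
    simp_rw [add_comm k]
    exact (summable_nat_add_iff k).2 p.weight_hasSum.summable
  exact (hs.le_tsum 0 fun i _ => p.weight_nonneg _).trans (hp.tail k hk)

/-- The complexity of the reference law is of the order of the rate. -/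
theorem PriorCondition.complexity_le {B C₁ C₂ C₃ C₄ c₀ c₁ : ℝ} (hα : 0 < α) (hC₃ : 0 < C₃)
    (hC₄ : 0 < C₄) (hc₁ : 0 < c₁) (hn : 2 ≤ n) {p : SievePrior}
    (hp : PriorCondition α C₁ C₂ C₃ C₄ c₀ c₁ n p) {θ : ℕ → ℝ} (hθ : θ ∈ sobolevBall α B) :
    -Real.log (p.weight (effDim α n)) + ∑ j ∈ Finset.range (effDim α n),
      (Real.log n / 2 + c₀ + c₁ * ((j : ℝ) + 1) ^ (2 * α + 1) *
        (truncate θ (effDim α n) j ^ 2 + (n : ℝ)⁻¹)) ≤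
      (2 * |Real.log C₃| + 6 * C₄ + 1 + 4 * |c₀| + 4 * c₁ * B ^ 2 + 8 * c₁ * 2 ^ (2 * α + 1)) *
        (realDim α n * Real.log n) := by
  set K := effDim α n
  set x := realDim α n
  set L := Real.log n
  have hL : 1 / 2 ≤ L := half_le_log hn
  have hx : 1 ≤ x := one_le_realDim hα hn
  have hK2 : (K : ℝ) ≤ 2 * x := effDim_le_two_mul_realDim hα hn
  have hlogK : Real.log K ≤ 3 * L := log_effDim_le hα hn
  have hlogK0 : 0 ≤ Real.log K := Real.log_natCast_nonneg K
  have hK0 : (0 : ℝ) ≤ K := by positivity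
  -- As `L ≥ 1/2` and `x ≥ 1`, both `x` and constants are absorbed into multiples of `x * L`.
  have hρ : x ≤ 2 * (x * L) := by nlinarith
  have hw : -Real.log (p.weight K) ≤ |Real.log C₃| + 6 * C₄ * (x * L) := by
    have h := Real.log_le_log (mul_pos hC₃ (Real.exp_pos _)) hp.mass
    rw [Real.log_mul hC₃.ne' (Real.exp_pos _).ne', Real.log_exp] at h
    have h1 : K * Real.log K ≤ 2 * x * (3 * L) :=
      mul_le_mul hK2 hlogK hlogK0 (by linarith)
    have h2 := mul_le_mul_of_nonneg_left h1 hC₄.le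
    have h3 := neg_abs_le (Real.log C₃)
    change Real.log C₃ + -C₄ * K * Real.log K ≤ Real.log (p.weight K) at h
    linarith
  have hsum : ∑ j ∈ Finset.range K, (L / 2 + c₀ + c₁ * ((j : ℝ) + 1) ^ (2 * α + 1) *
        (truncate θ K j ^ 2 + (n : ℝ)⁻¹)) = K * (L / 2 + c₀) +
      c₁ * ∑ j ∈ Finset.range K, ((j : ℝ) + 1) ^ (2 * α + 1) * truncate θ K j ^ 2 +
      c₁ * ∑ j ∈ Finset.range K, ((j : ℝ) + 1) ^ (2 * α + 1) * (n : ℝ)⁻¹ := by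
    rw [Finset.mul_sum, Finset.mul_sum, add_assoc, ← Finset.sum_add_distrib, Finset.sum_add_distrib,
      Finset.sum_const, Finset.card_range, nsmul_eq_mul]
    congr 1
    exact Finset.sum_congr rfl fun j _ => by ring
  have h1 := mul_le_mul_of_nonneg_left (sum_range_mul_truncate_sq_le hθ K) hc₁.le
  have h2 := mul_le_mul_of_nonneg_left (sum_range_rpow_div_le hα hn) hc₁.le
  have h3 : K * (L / 2 + c₀) ≤ x * L + 4 * |c₀| * (x * L) := by
    have e1 : K * (L / 2 + c₀) ≤ K * (L / 2 + |c₀|) :=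
      mul_le_mul_of_nonneg_left (by linarith [le_abs_self c₀]) hK0
    have e2 : K * (L / 2 + |c₀|) ≤ 2 * x * (L / 2 + |c₀|) :=
      mul_le_mul_of_nonneg_right hK2 (by positivity)
    have e3 := mul_le_mul_of_nonneg_right hρ (abs_nonneg c₀)
    linarith
  have h4 : c₁ * (K * B ^ 2) ≤ 4 * c₁ * B ^ 2 * (x * L) := by
    have e1 : (K : ℝ) ≤ 4 * (x * L) := by linarith
    have e2 := mul_le_mul_of_nonneg_right e1 (mul_nonneg hc₁.le (sq_nonneg B))
    linarith
  have h5 : |Real.log C₃| ≤ 2 * |Real.log C₃| * (x * L) := by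
    have e1 : 1 ≤ 2 * (x * L) := by linarith
    have e2 := mul_le_mul_of_nonneg_right e1 (abs_nonneg (Real.log C₃))
    linarith
  rw [hsum]
  linarith

end Rates

end GaussianSequence

/-! ### Choice of constants and conclusion -/

theorem mainTheorem4 (α B : ℝ) (hα : 0 < α) (hB : 0 < B)
    (C₁ C₂ C₃ C₄ c₀ c₁ : ℝ) (hC₁ : 0 < C₁) (hC₂ : 0 < C₂) (hC₃ : 0 < C₃) (hC₄ : 0 < C₄)
    (hc₁ : 0 < c₁) :
    ∃ M : ℝ, 0 < M ∧ ∀ n : ℕ, 2 ≤ n → ∀ p : GaussianSequence.SievePrior,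
      GaussianSequence.PriorCondition α C₁ C₂ C₃ C₄ c₀ c₁ n p →
      ∀ Qhat : Kernel (ℕ → ℝ) (ℕ → ℝ), GaussianSequence.IsVariationalPosterior n p Qhat →
      ∀ θstar ∈ GaussianSequence.sobolevBall α B,
        ∫⁻ Y, ∫⁻ θ, GaussianSequence.sqDist θ θstar ∂(Qhat Y)
            ∂(GaussianSequence.seqLaw n θstar) ≤
          ENNReal.ofReal (M * (n : ℝ) ^ (-(2 * α / (2 * α + 1))) *
            Real.log n ^ (2 * α / (2 * α + 1))) := by
  open GaussianSequence in
  -- The bound `1/32` serves the one-coordinate moment, and `C₂/64` keeps the sum over model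
  -- dimensions convergent.
  set a : ℝ := min (1 / 32) (C₂ / 64)
  have ha : 0 < a := lt_min (by norm_num) (by positivity)
  have ha1 : 32 * a ≤ 1 := by linarith [min_le_left (1 / 32) (C₂ / 64)]
  have ha2 : 64 * a ≤ C₂ := by linarith [min_le_right (1 / 32) (C₂ / 64)]
  -- The maximum with `1` ensures `c ≥ 1` below, hence `log c ≥ 0`.
  set S : ℝ := max 1 (C₁ ^ (1 / 4 : ℝ) * (1 - Real.exp (-C₂ / 8))⁻¹)
  have hS : 1 ≤ S := le_max_left _ _
  have hlogS : 0 ≤ Real.log S := Real.log_nonneg hS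
  set A : ℝ := 2 * |Real.log C₃| + 6 * C₄ + 1 + 4 * |c₀| + 4 * c₁ * B ^ 2 +
    8 * c₁ * 2 ^ (2 * α + 1)
  have hA : 0 < A := by positivity
  -- In units of `x * L ≥ 1/2`: `A` is the complexity, `4 log c` gives `8 log S + 4 B² + 4` (using
  -- `16a ≤ 1/2 ≤ L`), and the additive `4` gives `8`.
  refine ⟨(A + 8 * Real.log S + 4 * B ^ 2 + 12) / a, by positivity, ?_⟩
  intro n hn p hp Qhat hQ θs hθs
  have hn0 : n ≠ 0 := by omega
  have hnpos : (0 : ℝ) < n := by positivity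
  have hx := one_le_realDim hα hn
  have hL := half_le_log hn
  have hK2 := effDim_le_two_mul_realDim hα hn
  obtain ⟨hs, hT⟩ := mul_tsum_sub_truncate_le hα hn hθs
  set K := effDim α n
  set x := realDim α n
  set L := Real.log n
  have hρ : x ≤ 2 * (x * L) := by nlinarith
  have hρ0 : 0 < x * L := by nlinarith
  set c : ℝ := S * Real.exp (16 * a * x + B ^ 2 * (x * L))
  have hc : 1 ≤ c := one_le_mul_of_one_le_of_one_le hS (Real.one_le_exp (by positivity))
  have hlogc : Real.log c = Real.log S + (16 * a * x + B ^ 2 * (x * L)) := by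
    rw [Real.log_mul (by positivity) (Real.exp_pos _).ne', Real.log_exp]
  have hKw : 0 < p.weight K := (mul_pos hC₃ (Real.exp_pos _)).trans_le hp.mass
  have hcX : ∀ N, ∫⁻ Y, (∑' k, ENNReal.ofReal (p.weight k) *
      weightedEvidence n p a θs (truncate θs K) K N k Y) ^ (1 / 4 : ℝ) ∂(seqLaw n θs) ≤
      ENNReal.ofReal c := fun N => by
    refine (lintegral_tsum_weightedEvidence_rpow_le hn0 p hC₁ hC₂ hp.weight_le ha.le ha1 ha2
      (fun j hj => truncate_eq_zero θs hj) hs N).trans (ENNReal.ofReal_le_ofReal ?_)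
    refine mul_le_mul (le_max_right _ _) (Real.exp_le_exp.2 ?_) (Real.exp_pos _).le (by positivity)
    have := mul_le_mul_of_nonneg_left hK2 (show 0 ≤ 8 * a by positivity)
    linarith
  have hrisk := fun N => lintegral_variationalPosterior_le hn0 p hQ
    (summable_sq_of_mem_sobolevBall hα hθs) (fun j hj => truncate_eq_zero θs hj)
    (d := fun j => c₁ * ((j : ℝ) + 1) ^ (2 * α + 1)) hKw (fun j hj => hp.density j hj) ha.le N hc
    (show 0 ≤ A * (x * L) by positivity) (hcX N) (hp.complexity_le hα hC₃ hC₄ hc₁ hn hθs)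
  simp_rw [← mul_assoc a (n : ℝ)] at hrisk
  refine (lintegral_sqDist_le Qhat θs _ (show 0 < a * n by positivity) hrisk).trans
    (ENNReal.ofReal_le_ofReal ?_)
  rw [mul_assoc, rate_eq hα hn, hlogc, div_mul_div_comm]
  refine div_le_div_of_nonneg_right ?_ (by positivity)
  have h1 : Real.log S ≤ 2 * Real.log S * (x * L) := by nlinarith
  have h2 : 16 * a * x ≤ x * L := by nlinarith
  linarith
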